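/- Let $n$ be a multiple of $3$. (i) Let $P$ be a set of $n$ points in the plane, no three of them collinear. A line through two points of $P$ is a $j$-edge of $P$ if it leaves exactly $j$ points of $P$ on one of its sides; let $E_{\le k}(P)=\sum_{j=0}^{k}E_j(P)$, where $E_j(P)$ is the number of $j$-edges. If $E_{\le k}(P)=3\binom{k+2}{2}$ for every integer $k$ with $0\le k<n/3$, then $P$ is 3-decomposable: $P$ can be partitioned into three sets $A,B,C$ of equal size such that there is a triangle $T$ enclosing $P$ for which the orthogonal projections of $P$ onto the three sides of $T$ show $A$ between $B$ and $C$ on one side, $B$ between $C$ and $A$ on the second side, and $C$ between $A$ and $B$ on the third side. (ii) More generally, let $\mathbf{\Pi}=(\pi_t)_{t\in\mathbb Z}$ be an allowable sequence on $n$ elements (equivalently, a generalized configuration of $n$ points): each $\pi_t$ is a permutation of the elements, $\pi_{t+1}$ arises from $\pi_t$ by transposing two elements in neighboring positions, and $\pi_{t+\binom n2}$ is the reverse of $\pi_t$. A half-period of $\mathbf\Pi$ is a block $(\pi_s,\pi_{s+1},\dots,\pi_{s+\binom n2})$. A $j$-edge is a transposition in the half-period that exchanges the elements in positions $i,i+1$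 with $i=j+1$ or $i=n-j-1$, and a $(\le k)$-edge is a $j$-edge with $0\le j\le k$. If a half-period of $\mathbf\Pi$ has exactly $3\binom{k+2}{2}$ $(\le k)$-edges for every integer $k$ with $0\le k<n/3$, then $\mathbf\Pi$ is 3-decomposable: it contains a half-period whose first permutation consists of three consecutive blocks $A,B,C$ of $n/3$ elements each, in this order, and in which all transpositions between an element of $A$ and an element of $B$ occur before all transpositions between $C$ and $A\cup B$, and all transpositions between $A$ and $C$ occur before all transpositions between $B$ and $C$. -/

import Mathlib

noncomputable section

/-! Finite point sets in the Euclidean plane. -/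

/-- The Euclidean plane. -/
abbrev Plane : Type := EuclideanSpace ℝ (Fin 2)

/-- Twice the signed area of the triangle `p q r`: positive, zero or negative according to whether
`r` lies to the left of, on, or to the right of the line directed from `p` to `q`. -/
def signedArea (p q r : Plane) : ℝ :=
  (q 0 - p 0) * (r 1 - p 1) - (q 1 - p 1) * (r 0 - p 0)

/-- No three distinct points of `P` are collinear. -/
def InGeneralPosition (P : Finset Plane) : Prop :=
  ∀ p ∈ P, ∀ q ∈ P, ∀ r ∈ P, p ≠ q → p ≠ r → q ≠ r → ¬ Collinear ℝ ({p, q, r} : Set Plane)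

open Classical in
/-- The number of points of `P` strictly to the left of the line directed from `p` to `q`. -/
def numLeft (P : Finset Plane) (p q : Plane) : ℕ :=
  (P.filter fun r => 0 < signedArea p q r).card

/-- The pair `e` of points of `P` spans a `k`-edge: the line through the two points leaves exactly
`k` points of `P` on one side (the two orderings of the pair give the two sides). -/
def IsKEdge (P : Finset Plane) (k : ℕ) (e : Finset Plane) : Prop :=
  ∃ p ∈ P, ∃ q ∈ P, p ≠ q ∧ e = {p, q} ∧ numLeft P p q = k

open Classical in
/-- `E_k(P)`, the number of `k`-edges of a point set `P` in general position. In general position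
a line through two points of `P` is determined by, and determines, this pair of points. -/
def numKEdges (P : Finset Plane) (k : ℕ) : ℕ :=
  ((P.powersetCard 2).filter (IsKEdge P k)).card

/-- `E_{≤ k}(P) = E_0(P) + ⋯ + E_k(P)`, the number of `(≤ k)`-edges of `P`. -/
def numLEKEdges (P : Finset Plane) (k : ℕ) : ℕ :=
  ∑ j ∈ Finset.range (k + 1), numKEdges P j

/-- The orthogonal projection onto the line through `u` and `v` shows `Y` between `X` and `Z`.
The position of the projection of `x` along that line, in the direction from `u` to `v`, is measured
by the inner product of `v - u` with `x`. -/
def ProjectionShowsBetween (u v : Plane) (X Y Z : Finset Plane) : Prop :=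
  (∀ y ∈ Y, (∀ x ∈ X, inner ℝ (v - u) x < inner ℝ (v - u) y) ∧
    (∀ z ∈ Z, inner ℝ (v - u) y < inner ℝ (v - u) z)) ∨
  (∀ y ∈ Y, (∀ z ∈ Z, inner ℝ (v - u) z < inner ℝ (v - u) y) ∧
    (∀ x ∈ X, inner ℝ (v - u) y < inner ℝ (v - u) x))

open Classical in
/-- A finite point set `P` is 3-decomposable: it is partitioned into three sets `A`, `B`, `C` of the
same size, and there is a (nondegenerate) triangle `T` enclosing `P` such that the orthogonal
projections of `P` onto the three sides of `T` show `A` between `B` and `C`, `B` between `C` and `A`,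
and `C` between `A` and `B`, respectively. -/
def IsThreeDecomposable (P : Finset Plane) : Prop :=
  ∃ A B C : Finset Plane,
    Disjoint A B ∧ Disjoint A C ∧ Disjoint B C ∧ A ∪ B ∪ C = P ∧
    A.card = B.card ∧ B.card = C.card ∧
    ∃ T : Affine.Triangle ℝ Plane,
      (P : Set Plane) ⊆ interior (convexHull ℝ (Set.range T.points)) ∧
      ProjectionShowsBetween (T.points 0) (T.points 1) B A C ∧
      ProjectionShowsBetween (T.points 1) (T.points 2) C B A ∧
      ProjectionShowsBetween (T.points 2) (T.points 0) A C B

/-! Allowable sequences. -/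

/-- An allowable sequence on a set `α` of `n` elements: a doubly infinite sequence of permutations
of the elements (`perm t p` is the element in position `p` at time `t`), where consecutive
permutations differ by a transposition of two elements in neighboring positions, and permutations
`n.choose 2` steps apart are the reverse of each other. -/
structure AllowableSequence (n : ℕ) (α : Type*) where
  perm : ℤ → (Fin n ≃ α)
  step : ∀ t : ℤ, ∃ p q : Fin n, (p : ℕ) + 1 = q ∧ perm (t + 1) = (Equiv.swap p q).trans (perm t)
  reverse : ∀ (t : ℤ) (p : Fin n), perm (t + (n.choose 2 : ℕ)) p = perm t p.rev

namespace AllowableSequence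

variable {n : ℕ} {α : Type*}

/-- The step from time `t` to time `t + 1` is an `i`-transposition: it exchanges the elements in
the `i`-th and the `(i + 1)`-st position. Positions are counted from `1` here, so that the `i`-th
position is the element `i - 1` of `Fin n`. -/
def IsITransposition (S : AllowableSequence n α) (t : ℤ) (i : ℕ) : Prop :=
  ∃ p q : Fin n, (p : ℕ) + 1 = i ∧ (q : ℕ) = i ∧ S.perm (t + 1) = (Equiv.swap p q).trans (S.perm t)

/-- The step from time `t` to time `t + 1` is an `i`-critical transposition. -/
def IsCritical (S : AllowableSequence n α) (t : ℤ) (i : ℕ) : Prop :=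
  S.IsITransposition t i ∨ S.IsITransposition t (n - i)

open Classical in
/-- `N_{≤ k}(Π)`, the number of `(≤ k)`-critical transpositions in the half-period `Π` that starts
at time `s`, that is, `Π = (π_s, π_{s+1}, …, π_{s + n.choose 2})`. -/
def numLECritical (S : AllowableSequence n α) (s : ℤ) (k : ℕ) : ℕ :=
  ((Finset.range (n.choose 2)).filter
    fun j : ℕ => ∃ i, 1 ≤ i ∧ i ≤ k ∧ S.IsCritical (s + (j : ℤ)) i).card

/-- The number of `(≤ k)`-edges read off from the half-period that starts at time `s`: a `j`-edge
is a `(j + 1)`-critical transposition. -/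
def numLEKEdges (S : AllowableSequence n α) (s : ℤ) (k : ℕ) : ℕ :=
  S.numLECritical s (k + 1)

open Classical in
/-- The step from time `t` to time `t + 1` transposes the elements `x` and `y`. -/
def Transposes (S : AllowableSequence n α) (t : ℤ) (x y : α) : Prop :=
  x ≠ y ∧ S.perm (t + 1) = (S.perm t).trans (Equiv.swap x y)

/-- The permutation `π` shows exactly the elements of `X` in its first `n / 3` positions, exactly
those of `Y` in the next `n / 3` positions, and exactly those of `Z` in all later positions. -/
def Shows (π : Fin n ≃ α) (X Y Z : Set α) : Prop :=
  ∀ p : Fin n, (π p ∈ X ↔ (p : ℕ) < n / 3) ∧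
    (π p ∈ Y ↔ n / 3 ≤ (p : ℕ) ∧ (p : ℕ) < 2 * (n / 3)) ∧
    (π p ∈ Z ↔ 2 * (n / 3) ≤ (p : ℕ))

/-- The half-period that starts at time `s` is 3-decomposable: its first permutation shows `A`, then
`B`, then `C`, three sets of `n / 3` elements each, and within the half-period every transposition
between `A` and `B` occurs before every transposition between `C` and `A ∪ B`, and every
transposition between `A` and `C` occurs before every transposition between `B` and `C`. -/
def IsThreeDecomposableAt (S : AllowableSequence n α) (s : ℤ) : Prop :=
  3 ∣ n ∧ ∃ A B C : Set α, Shows (S.perm s) A B C ∧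
    (∀ t t' : ℤ, s ≤ t → t < s + (n.choose 2 : ℕ) → s ≤ t' → t' < s + (n.choose 2 : ℕ) →
      ∀ a ∈ A, ∀ b ∈ B, ∀ c ∈ C, ∀ x ∈ A ∪ B,
        S.Transposes t a b → S.Transposes t' c x → t < t') ∧
    (∀ t t' : ℤ, s ≤ t → t < s + (n.choose 2 : ℕ) → s ≤ t' → t' < s + (n.choose 2 : ℕ) →
      ∀ a ∈ A, ∀ b ∈ B, ∀ c ∈ C, ∀ c' ∈ C,
        S.Transposes t a c → S.Transposes t' b c' → t < t')

/-- An allowable sequence is 3-decomposable if one of its half-periods is. -/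
def IsThreeDecomposable (S : AllowableSequence n α) : Prop :=
  ∃ s : ℤ, S.IsThreeDecomposableAt s

end AllowableSequence

end

/-!
The permutations of an allowable sequence and the orders in which a rotating line sees a planar point
set are both instances of a `Sweep`. In the second case all pairs of points on parallel lines change
places in the same step, which does no harm, so no perturbation of the point set is needed. The
hypothesis says that, for `1 ≤ k ≤ n / 3`, a full period has exactly `3 * k` exchanges of the `k`-th
and the `(k + 1)`-st position; only the upper bound is used. Throughout, two elements change places
only twice in a full period, in places that are mirror images of each other
(`Sweep.Crosses.pos_add`), so they meet at most once in the first half of the positions.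

For `k = 1` the elements in front form a cycle of three elements `u i` (`Sweep.exists_hull`), and each
of them enters and leaves the first `k` positions exactly once in a period, for every `k`. By
induction on `k`, the first `k` positions are completely renewed three times in a period, by `k`
exchanges each: the `i`-th renewal starts when `u (i + 1)` enters and ends when `u i` leaves, and
nothing happens between the renewals (`Sweep.Hull.renews`). In the induction step, two consecutive
exchanges in a renewal have an exchange one position further between them, because the last old
element thrown out has to give way to the next new one (`Sweep.le_cnt_succ`). This makes `k - 1`
exchanges at the next position, and the passages of `u (i + 1)` and `u i` before and after make
`k + 1`. As there are at most `3 * (k + 1)` in total, there are no others. The sets of `k + 1`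
elements obtained are disjoint again, since the additional element of each of them meets its two
neighbors among the `u i` exactly one position further than the other elements do.

For `k = n / 3` this gives the three blocks `A`, `B`, `C`. While one of them replaces another in the
first third, neither `u i` nor `u (i + 1)` is in the last third, so that the last third is the
remaining block (`Sweep.exists_three_blocks`). For allowable sequences this yields the required
order of the transpositions. For point sets it yields three directions that show the orders `A B C`,
`B C A` and `C A B`. These directions are pairwise independent, so some triangle has sides parallel
to them, and it can be enlarged to enclose the points.
-/

/-! ### Sweeps -/

theorem exists_order_flip {f g : ℤ → ℕ} {s e : ℤ} (hse : s ≤ e) (hne : ∀ t, f t ≠ g t)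
    (hs : f s < g s) (he : g e < f e) : ∃ t, s ≤ t ∧ t < e ∧ f t < g t ∧ g (t + 1) < f (t + 1) := by
  induction e, hse using Int.leInduction with
  | base => omega
  | succ e hse ih =>
    rcases lt_or_gt_of_ne (hne e) with h | h
    · exact ⟨e, hse, by omega, h, he⟩
    · obtain ⟨t, h1, h2, h3⟩ := ih h
      exact ⟨t, h1, by omega, h3⟩

theorem exists_jump_up {f : ℤ → ℕ} {s e : ℤ} (hse : s ≤ e) {k : ℕ} (hs : f s < k) (he : k ≤ f e) :
    ∃ t, s ≤ t ∧ t < e ∧ f t < k ∧ k ≤ f (t + 1) := by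
  induction e, hse using Int.leInduction with
  | base => omega
  | succ e hse ih =>
    by_cases h : k ≤ f e
    · obtain ⟨t, h1, h2, h3⟩ := ih h
      exact ⟨t, h1, by omega, h3⟩
    · exact ⟨e, hse, by omega, by omega, he⟩

theorem exists_jump_down {f : ℤ → ℕ} {s e : ℤ} (hse : s ≤ e) {k : ℕ} (hs : k ≤ f s) (he : f e < k) :
    ∃ t, s ≤ t ∧ t < e ∧ k ≤ f t ∧ f (t + 1) < k := by
  induction e, hse using Int.leInduction with
  | base => omega
  | succ e hse ih =>
    by_cases h : f e < k
    · obtain ⟨t, h1, h2, h3⟩ := ih h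
      exact ⟨t, h1, by omega, h3⟩
    · exact ⟨e, hse, by omega, by omega, he⟩

/-- The orders in which a rotating line sees `n` elements, as a sequence with half-period `M`: at
time `t` the element `x` is in position `pos t x`, counted from `0`, and half a period reverses the
order. In a step no element moves by more than one position, so that a step exchanges disjoint pairs
of neighbors; there may be several of them, as for the parallel lines through pairs of points of a
planar set. By `dvd_of_crossings`, no two elements change places twice within a half-period. -/
structure Sweep (n M : ℕ) (α : Type*) where
  pos : ℤ → α → ℕ
  pos_lt : ∀ t x, pos t x < n
  inj : ∀ t, Function.Injective (pos t)
  surj : ∀ t p, p < n → ∃ x, pos t x = p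
  step_le : ∀ t x, pos (t + 1) x ≤ pos t x + 1
  le_step : ∀ t x, pos t x ≤ pos (t + 1) x + 1
  reverse : ∀ t x, pos (t + M) x + pos t x + 1 = n
  dvd_of_crossings : ∀ x y t t', pos t x < pos t y → pos (t + 1) y < pos (t + 1) x →
    pos t' x < pos t' y → pos (t' + 1) y < pos (t' + 1) x → (M : ℤ) ∣ t' - t

namespace Sweep

variable {n M : ℕ} {α : Type*} (S : Sweep n M α)

/-- Between the times `t` and `t + 1`, the element `x` is overtaken by `y`. -/
def Crosses (t : ℤ) (x y : α) : Prop :=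
  S.pos t x < S.pos t y ∧ S.pos (t + 1) y < S.pos (t + 1) x

/-- Some two elements exchange the positions `k - 1` and `k` between `t` and `t + 1`. -/
def SwapsAt (k : ℕ) (t : ℤ) : Prop :=
  ∃ x y, S.Crosses t x y ∧ S.pos t y = k

variable {S}

theorem Crosses.eqs {t : ℤ} {x y : α} (h : S.Crosses t x y) :
    S.pos t y = S.pos t x + 1 ∧ S.pos (t + 1) x = S.pos t x + 1 ∧ S.pos (t + 1) y = S.pos t x := by
  obtain ⟨h1, h2⟩ := h
  have := S.step_le t x
  have := S.le_step t y
  omega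

theorem Crosses.ne {t : ℤ} {x y : α} (h : S.Crosses t x y) : x ≠ y := by
  rintro rfl
  exact lt_irrefl _ h.1

/-- An element that moves backwards is overtaken by the one behind it: by induction on the
position, no element in front of it moves into the place it leaves. -/
theorem exists_crosses_of_succ {t : ℤ} {x : α} (h : S.pos (t + 1) x = S.pos t x + 1) :
    ∃ y, S.Crosses t x y := by
  obtain ⟨p, hp⟩ : ∃ p, S.pos t x = p := ⟨_, rfl⟩
  induction p using Nat.strong_induction_on generalizing x with
  | _ p ih =>
    obtain ⟨y, hy⟩ := S.surj (t + 1) p (hp ▸ S.pos_lt t x)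
    have h1 := S.step_le t y
    have h2 := S.le_step t y
    have hxy : S.pos t y ≠ p := by
      intro h0
      have : x = y := S.inj t (hp.trans h0.symm)
      subst this
      omega
    rcases Nat.lt_or_gt_of_ne hxy with h3 | h3
    · obtain ⟨z, hz⟩ := ih (S.pos t y) h3 (x := y) (by omega) rfl
      have e := hz.eqs
      have : z = x := S.inj t (by omega)
      subst this
      omega
    · exact ⟨y, by omega, by omega⟩

theorem Crosses.shift {t : ℤ} {x y : α} (h : S.Crosses t x y) : S.Crosses (t + M) y x := by
  have h1 := S.reverse t x
  have h2 := S.reverse t y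
  have h3 := S.reverse (t + 1) x
  have h4 := S.reverse (t + 1) y
  rw [show t + 1 + (M : ℤ) = t + M + 1 by ring] at h3 h4
  obtain ⟨h5, h6⟩ := h
  constructor <;> omega

variable (S) in
theorem pos_period (t : ℤ) (x : α) : S.pos (t + 2 * M) x = S.pos t x := by
  have h1 := S.reverse t x
  have h2 := S.reverse (t + M) x
  rw [show t + (M : ℤ) + M = t + 2 * M by ring] at h2
  omega

variable (S) in
theorem pos_period_mul (t z : ℤ) (x : α) : S.pos (t + 2 * M * z) x = S.pos t x := by
  induction z using Int.induction_on with
  | zero => simp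
  | succ i ih => rw [← ih, ← S.pos_period (t + 2 * M * i) x]; congr 1; ring
  | pred i ih => rw [← ih, ← S.pos_period _ x]; congr 1; ring

theorem crosses_period_mul {t z : ℤ} {x y : α} :
    S.Crosses (t + 2 * M * z) x y ↔ S.Crosses t x y := by
  unfold Crosses
  rw [add_right_comm, pos_period_mul, pos_period_mul, pos_period_mul, pos_period_mul]

theorem swapsAt_period {k : ℕ} {t : ℤ} : S.SwapsAt k (t + 2 * M) ↔ S.SwapsAt k t := by
  unfold SwapsAt
  have : t + 2 * (M : ℤ) = t + 2 * M * 1 := by ring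
  simp only [this, crosses_period_mul, pos_period_mul]

theorem exists_crosses_of_pred {t : ℤ} {x : α} (h : S.pos (t + 1) x + 1 = S.pos t x) :
    ∃ y, S.Crosses t y x := by
  have h1 := S.reverse t x
  have h3 := S.reverse (t + 1) x
  rw [show t + 1 + (M : ℤ) = t + M + 1 by ring] at h3
  obtain ⟨y, hy⟩ := exists_crosses_of_succ (S := S) (t := t + M) (x := x) (by omega)
  refine ⟨y, ?_⟩
  have := hy.shift
  rw [add_assoc, ← two_mul] at this
  simpa using (crosses_period_mul (S := S) (z := 1)).1 (by simpa using this)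

theorem Crosses.dvd {t t' : ℤ} {x y : α} (h : S.Crosses t x y)
    (h' : S.Crosses t' x y ∨ S.Crosses t' y x) : (M : ℤ) ∣ t' - t := by
  rcases h' with h' | h'
  · exact S.dvd_of_crossings x y t t' h.1 h.2 h'.1 h'.2
  · have h2 := h'.shift
    have := S.dvd_of_crossings x y t _ h.1 h.2 h2.1 h2.2
    have h3 : t' - t = (t' + M - t) - M := by ring
    rw [h3]
    exact dvd_sub_self_right.2 this

/-- Crossings of the same pair in the same order are a multiple of the full period apart. -/
theorem Crosses.two_dvd {t t' : ℤ} {x y : α} (h : S.Crosses t x y) (h' : S.Crosses t' x y) :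
    ∃ z, t' = t + 2 * M * z := by
  obtain ⟨z, hz⟩ := h.dvd (Or.inl h')
  rcases Int.even_or_odd' z with ⟨w, rfl | rfl⟩
  · exact ⟨w, by linarith⟩
  · exfalso
    have h1 := (crosses_period_mul (S := S) (z := w)).2 h.shift
    have : t + (M : ℤ) + 2 * M * w = t' := by linarith
    rw [this] at h1
    exact lt_asymm h1.1 h'.1

theorem Crosses.pos_eq {t t' : ℤ} {x y : α} (h : S.Crosses t x y) (h' : S.Crosses t' x y) :
    S.pos t y = S.pos t' y := by
  obtain ⟨z, rfl⟩ := h.two_dvd h'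
  rw [pos_period_mul]

/-- Crossings of the same pair in opposite orders take place in mirror-image positions. -/
theorem Crosses.pos_add {t t' : ℤ} {x y : α} (h : S.Crosses t x y) (h' : S.Crosses t' y x) :
    S.pos t y + S.pos t' x = n := by
  have h1 := h.shift.pos_eq h'
  have h2 := S.reverse t x
  have := h.eqs
  omega

theorem exists_crosses_between {s e : ℤ} (hse : s ≤ e) {x y : α} (hs : S.pos s x < S.pos s y)
    (he : S.pos e y < S.pos e x) : ∃ t, s ≤ t ∧ t < e ∧ S.Crosses t x y :=
  exists_order_flip (f := fun t => S.pos t x) (g := fun t => S.pos t y) hse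
    (fun t h => absurd (S.inj t h) (by rintro rfl; omega)) hs he

theorem not_crosses_of_lt {t t' : ℤ} {x y : α} (h : S.Crosses t x y)
    (h' : S.Crosses t' x y ∨ S.Crosses t' y x) (ht : t < t') (ht' : t' < t + M) : False := by
  have := Int.le_of_dvd (by omega) (h.dvd h')
  omega

/-- An element in front moves only backwards during the following half-period. -/
theorem pos_mono_of_first {s : ℤ} {x : α} (hs : S.pos s x = 0) {t t' : ℤ} (h1 : s ≤ t)
    (h2 : t ≤ t') (h3 : t' ≤ s + M) : S.pos t x ≤ S.pos t' x := by
  induction t', h2 using Int.leInduction with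
  | base => exact le_rfl
  | succ e hse ih =>
    refine (ih (by omega)).trans ?_
    by_contra hlt
    obtain ⟨y, hy⟩ := exists_crosses_of_pred (S := S) (t := e) (x := x) (by
      have := S.le_step e x
      omega)
    have : S.pos s y ≠ 0 := fun h => hy.ne (S.inj s (h.trans hs.symm))
    obtain ⟨t0, h4, h5, h6⟩ := exists_crosses_between (S := S) (s := s) (e := e) (x := x) (y := y)
      (by omega) (by omega) hy.1
    exact not_crosses_of_lt h6 (Or.inr hy) h5 (by omega)

/-- An element moves only forwards during the half-period before it comes to the front. -/
theorem pos_anti_of_first {e : ℤ} {x : α} (he : S.pos e x = 0) {t t' : ℤ} (h1 : e - M ≤ t)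
    (h2 : t ≤ t') (h3 : t' ≤ e) : S.pos t' x ≤ S.pos t x := by
  induction t', h2 using Int.leInduction with
  | base => exact le_rfl
  | succ s hse ih =>
    refine le_trans ?_ (ih (by omega))
    by_contra hlt
    obtain ⟨y, hy⟩ := exists_crosses_of_succ (S := S) (t := s) (x := x) (by
      have := S.step_le s x
      omega)
    have : S.pos e y ≠ 0 := fun h => hy.ne (S.inj e (he.trans h.symm))
    obtain ⟨t0, h4, h5, h6⟩ := exists_crosses_between (S := S) (s := s + 1) (e := e) (x := y)
      (y := x) (by omega) hy.2 (by omega)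
    exact not_crosses_of_lt hy (Or.inr h6) (by omega) (by omega)

theorem pos_of_enters {k : ℕ} {t : ℤ} {x : α} (h1 : k ≤ S.pos t x) (h2 : S.pos (t + 1) x < k) :
    ∃ y, S.Crosses t y x ∧ S.pos t x = k := by
  have := S.le_step t x
  obtain ⟨y, hy⟩ := exists_crosses_of_pred (S := S) (t := t) (x := x) (by omega)
  exact ⟨y, hy, by omega⟩

theorem pos_of_exits {k : ℕ} {t : ℤ} {x : α} (h1 : S.pos t x < k) (h2 : k ≤ S.pos (t + 1) x) :
    ∃ y, S.Crosses t x y ∧ S.pos t y = k := by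
  have := S.step_le t x
  obtain ⟨y, hy⟩ := exists_crosses_of_succ (S := S) (t := t) (x := x) (by omega)
  exact ⟨y, hy, by have := hy.eqs; omega⟩

section Prefix

variable [Fintype α]

variable (S) in
open Classical in
/-- The set of the elements in the first `k` positions at time `t`. -/
noncomputable def pre (k : ℕ) (t : ℤ) : Finset α := Finset.univ.filter fun x => S.pos t x < k

@[simp] theorem mem_pre {k : ℕ} {t : ℤ} {x : α} : x ∈ S.pre k t ↔ S.pos t x < k := by
  simp [pre]

theorem card_pre {k : ℕ} (hk : k ≤ n) (t : ℤ) : (S.pre k t).card = k := by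
  rw [← Finset.card_range k]
  refine Finset.card_bij (fun x _ => S.pos t x) (by simp) (fun x _ y _ h => S.inj t h) ?_
  intro p hp
  obtain ⟨x, hx⟩ := S.surj t p (by simp at hp; omega)
  exact ⟨x, by simpa [hx] using hp, hx⟩

theorem pre_succ_of_not_swapsAt {k : ℕ} {t : ℤ} (h : ¬ S.SwapsAt k t) :
    S.pre k (t + 1) = S.pre k t := by
  ext x
  rw [mem_pre, mem_pre]
  constructor
  · intro h1
    by_contra h2
    obtain ⟨y, hy, hk⟩ := pos_of_enters (by omega) h1
    exact h ⟨y, x, hy, hk⟩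
  · intro h1
    by_contra h2
    obtain ⟨y, hy, hk⟩ := pos_of_exits h1 (by omega)
    exact h ⟨x, y, hy, hk⟩

theorem pre_eq_of_not_swapsAt {k : ℕ} {s e : ℤ} (hse : s ≤ e)
    (h : ∀ t, s ≤ t → t < e → ¬ S.SwapsAt k t) : S.pre k e = S.pre k s := by
  induction e, hse using Int.leInduction with
  | base => rfl
  | succ e hse ih =>
    rw [pre_succ_of_not_swapsAt (h e hse (by omega)), ih fun t h1 h2 => h t h1 (by omega)]

theorem pre_period (k : ℕ) (t : ℤ) : S.pre k (t + 2 * M) = S.pre k t := by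
  ext x
  rw [mem_pre, mem_pre, pos_period]

end Prefix

variable (S) in
open Classical in
/-- The number of the exchanges of the positions `k - 1` and `k` at the times `t` with
`s ≤ t < e`. -/
noncomputable def cnt (k : ℕ) (s e : ℤ) : ℕ := ((Finset.Ico s e).filter (S.SwapsAt k)).card

theorem cnt_self (k : ℕ) (s : ℤ) : S.cnt k s s = 0 := by simp [cnt]

theorem cnt_add {k : ℕ} {a b c : ℤ} (h1 : a ≤ b) (h2 : b ≤ c) :
    S.cnt k a b + S.cnt k b c = S.cnt k a c := by
  classical
  unfold cnt
  rw [← Finset.Ico_union_Ico_eq_Ico h1 h2, Finset.filter_union, Finset.card_union_of_disjoint]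
  exact Finset.disjoint_filter_filter (Finset.Ico_disjoint_Ico_consecutive a b c)

theorem cnt_succ_of_swapsAt {k : ℕ} {t : ℤ} (h : S.SwapsAt k t) : S.cnt k t (t + 1) = 1 := by
  classical
  unfold cnt
  rw [show Finset.Ico t (t + 1) = {t} by ext; simp; omega, Finset.filter_singleton, if_pos h]
  simp

theorem cnt_succ_of_not_swapsAt {k : ℕ} {t : ℤ} (h : ¬ S.SwapsAt k t) : S.cnt k t (t + 1) = 0 := by
  classical
  unfold cnt
  rw [show Finset.Ico t (t + 1) = {t} by ext; simp; omega, Finset.filter_singleton, if_neg h]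
  simp

theorem not_swapsAt_of_cnt_eq_zero {k : ℕ} {s e t : ℤ} (h : S.cnt k s e = 0) (h1 : s ≤ t)
    (h2 : t < e) : ¬ S.SwapsAt k t := by
  classical
  unfold cnt at h
  rw [Finset.card_eq_zero] at h
  intro h3
  have : t ∈ (Finset.Ico s e).filter (S.SwapsAt k) := by simp [h1, h2, h3]
  rw [h] at this
  simp at this

end Sweep

/-! ### The elements that come to the front -/

namespace Sweep

variable {n M : ℕ} {α : Type*} {S : Sweep n M α}

variable (S) in
/-- The elements that come to the front during a full period form a cycle of length three: `u i` is
in front at the times `t` with `T (i - 1) < t ≤ T i`. -/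
structure Hull where
  T : ℤ → ℤ
  u : ℤ → α
  T_lt : ∀ i, T i < T (i + 1)
  T_period : ∀ i, T (i + 3) = T i + 2 * M
  u_period : ∀ i, u (i + 3) = u i
  u_ne : ∀ i, u i ≠ u (i + 1)
  first : ∀ i t, T i < t → t ≤ T (i + 1) → S.pos t (u (i + 1)) = 0

theorem half_period_pos (S : Sweep n M α) (hn : 2 ≤ n) : 1 ≤ M := by
  by_contra h
  have hM : M = 0 := by omega
  subst hM
  obtain ⟨x, hx⟩ := S.surj 0 0 (by omega)
  have := S.reverse 0 x
  simp only [Nat.cast_zero, add_zero] at this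
  omega

theorem exists_swapsAt_one (hn : 2 ≤ n) (t : ℤ) : ∃ s, t ≤ s ∧ S.SwapsAt 1 s := by
  obtain ⟨x, hx⟩ := S.surj t 0 (by omega)
  have h := S.reverse t x
  obtain ⟨s, h1, -, h2, h3⟩ := exists_jump_up (f := fun s => S.pos s x) (s := t) (e := t + M)
    (k := 1) (by omega) (by omega) (by omega)
  obtain ⟨y, hy, hk⟩ := pos_of_exits h2 h3
  exact ⟨s, h1, x, y, hy, hk⟩

/-- The next change of the element in front. -/
theorem exists_next (hn : 2 ≤ n) (t : ℤ) : ∃ t' x, t < t' ∧ S.SwapsAt 1 t' ∧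
    (∀ s, t < s → s ≤ t' → S.pos s x = 0) ∧ ∀ s, t < s → S.SwapsAt 1 s → t' ≤ s := by
  classical
  have hex : ∃ j : ℕ, S.SwapsAt 1 (t + 1 + j) := by
    obtain ⟨s, h1, h2⟩ := exists_swapsAt_one (S := S) hn (t + 1)
    refine ⟨(s - (t + 1)).toNat, ?_⟩
    rw [Int.toNat_of_nonneg (by omega)]
    simpa using h2
  have hmin : ∀ s, t < s → S.SwapsAt 1 s → t + 1 + (Nat.find hex : ℤ) ≤ s := by
    intro s h1 h2
    have : Nat.find hex ≤ (s - (t + 1)).toNat := by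
      apply Nat.find_min'
      rw [Int.toNat_of_nonneg (by omega)]
      simpa using h2
    omega
  obtain ⟨x, hx⟩ := S.surj (t + 1) 0 (by omega)
  refine ⟨t + 1 + Nat.find hex, x, by omega, Nat.find_spec hex, ?_, hmin⟩
  intro s h1 h2
  have h3 : t + 1 ≤ s := h1
  induction s, h3 using Int.leInduction with
  | base => exact hx
  | succ s h3 ih =>
    have h4 := ih (by omega) (by omega)
    by_contra h5
    obtain ⟨y, hy, hk⟩ := pos_of_exits (S := S) (k := 1) (t := s) (x := x) (by omega) (by omega)
    have := hmin s (by omega) ⟨x, y, hy, hk⟩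
    omega

theorem front_changes {t : ℤ} {x : α} (h : S.SwapsAt 1 t) (hx : S.pos t x = 0) :
    S.pos (t + 1) x = 1 := by
  obtain ⟨a, b, hab, hb⟩ := h
  have e := hab.eqs
  have : a = x := S.inj t (by omega)
  subst this
  omega

/-- If the element in front changes at most three times in every full period, then it changes
exactly three times: a single change cannot bring back the old element, and with two changes some
pair would exchange the two first positions twice in a full period. -/
theorem exists_hull (hn : 3 ≤ n) (hcnt : ∀ s, S.cnt 1 s (s + 2 * M) ≤ 3) : Nonempty S.Hull := by
  classical
  have hM := half_period_pos S (by omega)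
  obtain ⟨t₁, x₁, h01, hs₁, hf₁, -⟩ := exists_next (S := S) (by omega) 0
  have hx₁ : S.pos t₁ x₁ = 0 := hf₁ t₁ (by omega) le_rfl
  obtain ⟨t₂, x₂, h12, hs₂, hf₂, hm₂⟩ := exists_next (S := S) (by omega) t₁
  obtain ⟨t₃, x₃, h23, hs₃, hf₃, hm₃⟩ := exists_next (S := S) (by omega) t₂
  obtain ⟨t₄, x₄, h34, hs₄, hf₄, hm₄⟩ := exists_next (S := S) (by omega) t₃
  have hend : S.SwapsAt 1 (t₁ + 2 * M) := swapsAt_period.2 hs₁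
  have hendx : S.pos (t₁ + 2 * M) x₁ = 0 := by rw [pos_period, hx₁]
  have h2 : t₂ ≤ t₁ + 2 * M := hm₂ _ (by omega) hend
  have hne12 : x₁ ≠ x₂ := by
    rintro rfl
    have h1 := front_changes hs₁ hx₁
    have h2 := hf₂ (t₁ + 1) (by omega) (by omega)
    omega
  have hne23 : x₂ ≠ x₃ := by
    rintro rfl
    have h1 := front_changes hs₂ (hf₂ t₂ (by omega) le_rfl)
    have h2 := hf₃ (t₂ + 1) (by omega) (by omega)
    omega
  have hne34 : x₃ ≠ x₄ := by
    rintro rfl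
    have h1 := front_changes hs₃ (hf₃ t₃ (by omega) le_rfl)
    have h2 := hf₄ (t₃ + 1) (by omega) (by omega)
    omega
  have h2' : t₂ < t₁ + 2 * M := by
    refine lt_of_le_of_ne h2 fun h => hne12 (S.inj (t₁ + 2 * M) ?_)
    rw [hendx, hf₂ _ (by omega) (by omega)]
  have h3 : t₃ ≤ t₁ + 2 * M := hm₃ _ (by omega) hend
  have h3' : t₃ < t₁ + 2 * M := by
    refine lt_of_le_of_ne h3 fun h => ?_
    have hx : x₁ = x₃ := S.inj (t₁ + 2 * M) (by rw [hendx, hf₃ _ (by omega) (by omega)])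
    subst hx
    have e1 : S.Crosses t₁ x₁ x₂ := by
      have h4 := front_changes hs₁ hx₁
      have h5 := hf₂ (t₁ + 1) (by omega) (by omega)
      have : S.pos t₁ x₂ ≠ 0 := fun h => hne12 (S.inj t₁ (by omega))
      constructor <;> omega
    have e2 : S.Crosses t₂ x₂ x₁ := by
      have h3 := hf₂ t₂ (by omega) le_rfl
      have h4 := front_changes hs₂ h3
      have h5 := hf₃ (t₂ + 1) (by omega) (by omega)
      have : S.pos t₂ x₁ ≠ 0 := fun h => hne12 (S.inj t₂ (by omega))
      constructor <;> omega
    have := e1.pos_add e2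
    have := e1.eqs
    have := e2.eqs
    have := hf₂ t₂ (by omega) le_rfl
    omega
  have h4 : t₄ = t₁ + 2 * M := by
    have h4 : t₄ ≤ t₁ + 2 * M := hm₄ _ (by omega) hend
    by_contra hne
    have hsub : ({t₁, t₂, t₃, t₄} : Finset ℤ) ⊆
        (Finset.Ico t₁ (t₁ + 2 * M)).filter (S.SwapsAt 1) := by
      intro t ht
      simp only [Finset.mem_insert, Finset.mem_singleton] at ht
      rw [Finset.mem_filter, Finset.mem_Ico]
      rcases ht with rfl | rfl | rfl | rfl
      · exact ⟨by omega, hs₁⟩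
      · exact ⟨by omega, hs₂⟩
      · exact ⟨by omega, hs₃⟩
      · exact ⟨by omega, hs₄⟩
    have h5 := Finset.card_le_card hsub
    have h6 : ({t₁, t₂, t₃, t₄} : Finset ℤ).card = 4 := by
      rw [Finset.card_insert_of_notMem, Finset.card_insert_of_notMem,
        Finset.card_insert_of_notMem, Finset.card_singleton] <;>
      simp only [Finset.mem_insert, Finset.mem_singleton] <;> omega
    have := hcnt t₁
    unfold cnt at this
    omega
  have h41 : x₄ = x₁ := S.inj (t₁ + 2 * M) (by rw [hendx, hf₄ _ (by omega) (by omega)])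
  subst h41
  let T : ℤ → ℤ := fun i =>
    (if i % 3 = 0 then t₁ else if i % 3 = 1 then t₂ else t₃) + 2 * M * (i / 3)
  let u : ℤ → α := fun i => if i % 3 = 0 then x₄ else if i % 3 = 1 then x₂ else x₃
  have hT0 : ∀ q : ℤ, T (3 * q) = t₁ + 2 * M * q := fun q => by simp [T]
  have hT1 : ∀ q : ℤ, T (3 * q + 1) = t₂ + 2 * M * q := fun q => by
    have h1 : (3 * q + 1) % 3 = 1 := by omega
    have h2 : (3 * q + 1) / 3 = q := by omega
    simp [T, h1, h2]
  have hT2 : ∀ q : ℤ, T (3 * q + 2) = t₃ + 2 * M * q := fun q => by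
    have h1 : (3 * q + 2) % 3 = 2 := by omega
    have h2 : (3 * q + 2) / 3 = q := by omega
    simp [T, h1, h2]
  have hu0 : ∀ q : ℤ, u (3 * q) = x₄ := fun q => by simp [u]
  have hu1 : ∀ q : ℤ, u (3 * q + 1) = x₂ := fun q => by
    have h1 : (3 * q + 1) % 3 = 1 := by omega
    simp [u, h1]
  have hu2 : ∀ q : ℤ, u (3 * q + 2) = x₃ := fun q => by
    have h1 : (3 * q + 2) % 3 = 2 := by omega
    simp [u, h1]
  have hT3 : ∀ q : ℤ, T (3 * q + 2 + 1) = t₄ + 2 * M * q := fun q => by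
    rw [show 3 * q + 2 + 1 = 3 * (q + 1) by ring, hT0, h4]; ring
  have hu3 : ∀ q : ℤ, u (3 * q + 2 + 1) = x₄ := fun q => by
    rw [show 3 * q + 2 + 1 = 3 * (q + 1) by ring, hu0]
  have hcases : ∀ i : ℤ, ∃ q, i = 3 * q ∨ i = 3 * q + 1 ∨ i = 3 * q + 2 := fun i =>
    ⟨i / 3, by omega⟩
  have hpos : ∀ t q x, S.pos (t - 2 * M * q) x = S.pos t x := fun t q x => by
    rw [← S.pos_period_mul _ q]; congr 1; ring
  refine ⟨⟨T, u, fun i => ?_, fun i => ?_, fun i => ?_, fun i => ?_, fun i t ha hb => ?_⟩⟩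
  · obtain ⟨q, rfl | rfl | rfl⟩ := hcases i
    · rw [hT0, hT1]; omega
    · rw [hT1, add_assoc]; norm_num; rw [hT2]; omega
    · rw [hT2, hT3]; omega
  · have h1 : (i + 3) % 3 = i % 3 := by omega
    have h2 : (i + 3) / 3 = i / 3 + 1 := by omega
    simp only [T, h1, h2]
    ring
  · have h1 : (i + 3) % 3 = i % 3 := by omega
    simp only [u, h1]
  · obtain ⟨q, rfl | rfl | rfl⟩ := hcases i
    · rw [hu0, hu1]; exact hne12
    · rw [hu1, add_assoc]; norm_num; rw [hu2]; exact hne23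
    · rw [hu2, hu3]; exact hne34
  · obtain ⟨q, rfl | rfl | rfl⟩ := hcases i
    · rw [hT0] at ha
      rw [hT1] at hb
      rw [hu1, ← hpos t q]
      exact hf₂ _ (by omega) (by omega)
    · rw [hT1] at ha
      rw [add_assoc] at hb ⊢
      norm_num at hb ⊢
      rw [hT2] at hb
      rw [hu2, ← hpos t q]
      exact hf₃ _ (by omega) (by omega)
    · rw [hT2] at ha
      rw [hT3] at hb
      rw [hu3, ← hpos t q]
      exact hf₄ _ (by omega) (by omega)

namespace Hull

variable (H : S.Hull)

theorem first_end (i : ℤ) : S.pos (H.T i) (H.u i) = 0 := by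
  have h1 := H.T_lt (i - 1)
  have h2 := H.first (i - 1) (H.T i)
  rw [sub_add_cancel] at h1 h2
  exact h2 h1 le_rfl

theorem first_start (i : ℤ) : S.pos (H.T i + 1) (H.u (i + 1)) = 0 :=
  H.first i _ (by omega) (H.T_lt i)

theorem crosses (i : ℤ) : S.Crosses (H.T i) (H.u i) (H.u (i + 1)) := by
  have h1 := H.first_end i
  have h2 := H.first_start i
  have h3 : S.pos (H.T i) (H.u (i + 1)) ≠ 0 := fun h => H.u_ne i (S.inj _ (h1.trans h.symm))
  have h4 : S.pos (H.T i + 1) (H.u i) ≠ 0 := fun h => H.u_ne i (S.inj _ (h.trans h2.symm))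
  constructor <;> omega

theorem not_swapsAt_one {i t : ℤ} (h1 : H.T i < t) (h2 : t < H.T (i + 1)) : ¬ S.SwapsAt 1 t := by
  intro h
  have := front_changes h (H.first i t h1 h2.le)
  have := H.first i (t + 1) (by omega) h2
  omega

/-- The element `u i` leaves the first `k` positions once after having been in front. -/
theorem exists_out {k : ℕ} (hk : 1 ≤ k) (hkn : k < n) (i : ℤ) :
    ∃ t, H.T i ≤ t ∧ t < H.T i + M ∧ S.pos t (H.u i) + 1 = k ∧ S.pos (t + 1) (H.u i) = k := by
  have h0 := H.first_end i
  have h := S.reverse (H.T i) (H.u i)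
  obtain ⟨t, h1, h2, h3, h4⟩ := exists_jump_up (f := fun s => S.pos s (H.u i)) (s := H.T i)
    (e := H.T i + M) (k := k) (by omega) (by omega) (by omega)
  have := S.step_le t (H.u i)
  exact ⟨t, h1, h2, by omega, by omega⟩

/-- The element `u (i + 1)` enters the first `k` positions once before coming to the front. -/
theorem exists_in {k : ℕ} (hk : 1 ≤ k) (hkn : k < n) (i : ℤ) :
    ∃ t, H.T i + 1 - M ≤ t ∧ t < H.T i + 1 ∧ S.pos t (H.u (i + 1)) = k ∧
      S.pos (t + 1) (H.u (i + 1)) + 1 = k := by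
  have h0 := H.first_start i
  have h := S.reverse (H.T i + 1 - M) (H.u (i + 1))
  rw [sub_add_cancel] at h
  obtain ⟨t, h1, h2, h3, h4⟩ := exists_jump_down (f := fun s => S.pos s (H.u (i + 1)))
    (s := H.T i + 1 - M) (e := H.T i + 1) (k := k) (by omega) (by omega)
    (by omega)
  have := S.le_step t (H.u (i + 1))
  exact ⟨t, h1, h2, by omega, by omega⟩

end Hull

end Sweep

/-! ### Entering and leaving the first positions -/

namespace Sweep

variable {n M : ℕ} {α : Type*} {S : Sweep n M α}

namespace Hull

variable (H : S.Hull)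

open Classical in
/-- The last time at which `u (i + 1)` is still outside the first `k` positions before coming to the
front (a junk value unless `1 ≤ k < n`). -/
noncomputable def enter (k : ℕ) (i : ℤ) : ℤ :=
  if h : 1 ≤ k ∧ k < n then (H.exists_in h.1 h.2 i).choose else 0

open Classical in
/-- The last time at which `u i` is still among the first `k` positions after having been in front
(a junk value unless `1 ≤ k < n`). -/
noncomputable def exit (k : ℕ) (i : ℤ) : ℤ :=
  if h : 1 ≤ k ∧ k < n then (H.exists_out h.1 h.2 i).choose else 0

variable {k : ℕ}

theorem enter_spec (hk : 1 ≤ k) (hkn : k < n) (i : ℤ) :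
    H.T i + 1 - M ≤ H.enter k i ∧ H.enter k i < H.T i + 1 ∧
      S.pos (H.enter k i) (H.u (i + 1)) = k ∧ S.pos (H.enter k i + 1) (H.u (i + 1)) + 1 = k := by
  unfold enter
  rw [dif_pos ⟨hk, hkn⟩]
  exact (H.exists_in hk hkn i).choose_spec

theorem exit_spec (hk : 1 ≤ k) (hkn : k < n) (i : ℤ) :
    H.T i ≤ H.exit k i ∧ H.exit k i < H.T i + M ∧
      S.pos (H.exit k i) (H.u i) + 1 = k ∧ S.pos (H.exit k i + 1) (H.u i) = k := by
  unfold exit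
  rw [dif_pos ⟨hk, hkn⟩]
  exact (H.exists_out hk hkn i).choose_spec

theorem enter_le_exit (hk : 1 ≤ k) (hkn : k < n) (i : ℤ) : H.enter k i ≤ H.exit k i := by
  have := H.enter_spec hk hkn i
  have := H.exit_spec hk hkn i
  omega

/-- Between entering and leaving, `u (i + 1)` stays among the first `k` elements. -/
theorem pos_lt_of_mem (hk : 1 ≤ k) (hkn : k < n) {i t : ℤ} (h1 : H.enter k i < t)
    (h2 : t ≤ H.exit k (i + 1)) : S.pos t (H.u (i + 1)) < k := by
  obtain ⟨a1, a2, a3, a4⟩ := H.enter_spec hk hkn i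
  obtain ⟨b1, b2, b3, b4⟩ := H.exit_spec hk hkn (i + 1)
  by_cases h3 : t ≤ H.T i + 1
  · have := pos_anti_of_first (H.first_start i) (t := H.enter k i + 1) (t' := t) (by omega)
      (by omega) (by omega)
    omega
  by_cases h4 : t ≤ H.T (i + 1)
  · rw [H.first i t (by omega) h4]
    omega
  · have := pos_mono_of_first (H.first_end (i + 1)) (t := t) (t' := H.exit k (i + 1)) (by omega)
      (by omega) (by omega)
    omega

variable {H} in
theorem u_period_two (i : ℤ) : H.u (i + 2 + 1) = H.u i := by
  rw [add_assoc]
  exact H.u_period i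

variable {H} in
theorem T_period_two (i : ℤ) : H.T (i + 2 + 1) = H.T i + 2 * M := by
  rw [add_assoc]
  exact H.T_period i

theorem enter_period (hk : 1 ≤ k) (hkn : k < n) (i : ℤ) :
    H.enter k (i + 3) = H.enter k i + 2 * M := by
  obtain ⟨a1, a2, a3, a4⟩ := H.enter_spec hk hkn i
  obtain ⟨c1, c2, c3, c4⟩ := H.enter_spec hk hkn (i + 3)
  have b1 := (H.exit_spec hk hkn (i + 1)).1
  have b2 := (H.exit_spec hk hkn (i + 3 + 1)).1
  have h1 := H.T_lt i
  have h2 := H.T_lt (i + 3)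
  have h3 := H.T_period i
  have hu : H.u (i + 3 + 1) = H.u (i + 1) := by rw [add_right_comm, H.u_period]
  rcases lt_trichotomy (H.enter k (i + 3)) (H.enter k i + 2 * M) with h | h | h
  · have := H.pos_lt_of_mem hk hkn h (by omega)
    rw [hu, pos_period] at this
    omega
  · exact h
  · have := H.pos_lt_of_mem hk hkn (i := i) (t := H.enter k (i + 3) - 2 * M) (by omega) (by omega)
    rw [← pos_period, sub_add_cancel, ← hu] at this
    omega

variable {H} in
theorem exit_period (hk : 1 ≤ k) (hkn : k < n) (i : ℤ) :
    H.exit k (i + 3) = H.exit k i + 2 * M := by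
  obtain ⟨a1, a2, a3, a4⟩ := H.exit_spec hk hkn i
  obtain ⟨c1, c2, c3, c4⟩ := H.exit_spec hk hkn (i + 3)
  have h3 := H.T_period i
  have hu : H.u (i + 3) = H.u i := H.u_period i
  have p1 := S.pos_period (H.exit k i) (H.u i)
  have p2 := S.pos_period (H.exit k i + 1) (H.u i)
  rw [add_right_comm] at p2
  rw [hu] at c3 c4
  have h0 := H.first_end (i + 3)
  rw [hu] at h0
  rcases lt_trichotomy (H.exit k (i + 3)) (H.exit k i + 2 * M) with h | h | h
  · have := pos_mono_of_first h0 (t := H.exit k (i + 3) + 1) (t' := H.exit k i + 2 * M) (by omega)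
      (by omega) (by omega)
    omega
  · exact h
  · have := pos_mono_of_first h0 (t := H.exit k i + 2 * M + 1) (t' := H.exit k (i + 3)) (by omega)
      (by omega) (by omega)
    omega

/-- Before `u (i + 2)` enters the first `k` positions, `u i` has left them: the two meet in the last
two positions in between, half a period before they meet in front. -/
theorem exit_lt_enter (hk : 1 ≤ k) (hkn : k + 2 ≤ n) (i : ℤ) :
    H.exit k i < H.enter k (i + 1) := by
  have hM := half_period_pos S (by omega)
  have h0 := H.first_end (i + 2)
  have h1 := (H.crosses (i + 2)).eqs.1
  rw [u_period_two] at h1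
  have r1 := S.reverse (H.T (i + 2) - M) (H.u (i + 2))
  have r2 := S.reverse (H.T (i + 2) - M) (H.u i)
  rw [sub_add_cancel] at r1 r2
  have hT := T_period_two (H := H) (i - 1)
  rw [show i - 1 + 2 + 1 = i + 2 by ring] at hT
  have e1 := H.enter_spec hk (by omega) (i - 1)
  have x1 := H.exit_spec hk (by omega) (i + 2)
  have h2 : H.exit k i < H.T (i + 2) - M := by
    by_contra h
    have := H.pos_lt_of_mem hk (by omega) (i := i - 1) (t := H.T (i + 2) - M) (by omega)
      (by rw [sub_add_cancel]; omega)
    rw [sub_add_cancel] at this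
    omega
  have h3 : H.T (i + 2) - M ≤ H.enter k (i + 1) := by
    by_contra h
    have := H.pos_lt_of_mem hk (by omega) (i := i + 1) (t := H.T (i + 2) - M) (by omega)
      (by rw [show i + 1 + 1 = i + 2 by ring]; omega)
    rw [show i + 1 + 1 = i + 2 by ring] at this
    omega
  omega

/-- The larger the set of positions, the earlier the entrance and the later the exit. -/
theorem enter_succ_lt (hk : 1 ≤ k) (hkn : k + 1 < n) (i : ℤ) :
    H.enter (k + 1) i < H.enter k i := by
  have e1 := H.enter_spec hk (by omega) i
  have e2 := H.enter_spec (k := k + 1) (by omega) hkn i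
  have x1 := H.exit_spec hk (by omega) (i + 1)
  have := H.T_lt i
  by_contra h
  rcases eq_or_lt_of_le (not_lt.1 h) with h | h
  · rw [← h] at e2
    omega
  · have := H.pos_lt_of_mem hk (by omega) h (by omega)
    omega

theorem exit_lt_succ (hk : 1 ≤ k) (hkn : k + 1 < n) (i : ℤ) :
    H.exit k i < H.exit (k + 1) i := by
  have e1 := H.enter_spec hk (by omega) (i - 1)
  have x1 := H.exit_spec hk (by omega) i
  have x2 := H.exit_spec (k := k + 1) (by omega) hkn i
  have := H.T_lt (i - 1)
  rw [sub_add_cancel] at this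
  by_contra h
  have := H.pos_lt_of_mem hk (by omega) (i := i - 1) (t := H.exit (k + 1) i) (by omega)
    (by rw [sub_add_cancel]; omega)
  rw [sub_add_cancel] at this
  omega

theorem crosses_enter (hk : 1 ≤ k) (hkn : k < n) (i : ℤ) :
    ∃ y, S.Crosses (H.enter k i) y (H.u (i + 1)) := by
  have e1 := H.enter_spec hk hkn i
  exact exists_crosses_of_pred (by omega)

theorem crosses_exit (hk : 1 ≤ k) (hkn : k < n) (i : ℤ) :
    ∃ y, S.Crosses (H.exit k i) (H.u i) y := by
  have e1 := H.exit_spec hk hkn i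
  exact exists_crosses_of_succ (by omega)

theorem swapsAt_enter (hk : 1 ≤ k) (hkn : k < n) (i : ℤ) : S.SwapsAt k (H.enter k i) := by
  obtain ⟨y, hy⟩ := H.crosses_enter hk hkn i
  exact ⟨y, _, hy, (H.enter_spec hk hkn i).2.2.1⟩

theorem swapsAt_exit (hk : 1 ≤ k) (hkn : k < n) (i : ℤ) : S.SwapsAt k (H.exit k i) := by
  obtain ⟨y, hy⟩ := H.crosses_exit hk hkn i
  have := hy.eqs
  have := H.exit_spec hk hkn i
  exact ⟨_, y, hy, by omega⟩

end Hull

section Exchange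

variable [Fintype α]

open Classical in
theorem pre_succ_of_crosses {k : ℕ} {t : ℤ} {x y : α} (h : S.Crosses t x y) (hy : S.pos t y = k) :
    S.pre k (t + 1) = insert y ((S.pre k t).erase x) := by
  have e := h.eqs
  ext z
  rw [Finset.mem_insert, Finset.mem_erase, mem_pre, mem_pre]
  constructor
  · intro h1
    by_cases h2 : S.pos t z < k
    · refine Or.inr ⟨?_, h2⟩
      rintro rfl
      omega
    · obtain ⟨w, hw, hk⟩ := pos_of_enters (by omega) h1
      exact Or.inl (S.inj t (by omega))
  · rintro (rfl | ⟨h1, h2⟩)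
    · omega
    · by_contra h3
      obtain ⟨w, hw, hk⟩ := pos_of_exits h2 (by omega)
      have := hw.eqs
      exact h1 (S.inj t (by omega))

open Classical in
theorem card_inter_succ_le (k : ℕ) (t : ℤ) (Y : Finset α) :
    (S.pre k (t + 1) ∩ Y).card ≤ (S.pre k t ∩ Y).card + S.cnt k t (t + 1) := by
  by_cases h : S.SwapsAt k t
  · rw [cnt_succ_of_swapsAt h]
    obtain ⟨x, y, hxy, hy⟩ := h
    refine (Finset.card_le_card ?_).trans (Finset.card_insert_le y _)
    rw [pre_succ_of_crosses hxy hy]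
    intro z
    simp only [Finset.mem_inter, Finset.mem_insert, Finset.mem_erase]
    tauto
  · rw [pre_succ_of_not_swapsAt h]
    omega

open Classical in
theorem card_inter_le {k : ℕ} {s e : ℤ} (hse : s ≤ e) (Y : Finset α) :
    (S.pre k e ∩ Y).card ≤ (S.pre k s ∩ Y).card + S.cnt k s e := by
  induction e, hse using Int.leInduction with
  | base => omega
  | succ e hse ih =>
    rw [← cnt_add hse (by omega : e ≤ e + 1)]
    have := S.card_inter_succ_le k e Y
    omega

variable {k : ℕ} {s e : ℤ}

theorem le_cnt_of_disjoint (hk : k ≤ n) (hse : s ≤ e)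
    (hd : Disjoint (S.pre k s) (S.pre k e)) : k ≤ S.cnt k s e := by
  classical
  have := card_inter_le (S := S) (k := k) hse (S.pre k e)
  rw [Finset.inter_self, card_pre hk, Finset.disjoint_iff_inter_eq_empty.1 hd] at this
  simpa using this

/-- If the first `k` positions are completely renewed by only `k` exchanges, then each of these
exchanges brings in a new element for an old one. -/
theorem crosses_of_cnt_le (hk : k ≤ n) (hd : Disjoint (S.pre k s) (S.pre k e))
    (hc : S.cnt k s e ≤ k) {t : ℤ} (h1 : s ≤ t) (h2 : t < e) {x y : α} (hxy : S.Crosses t x y)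
    (hy : S.pos t y = k) : y ∈ S.pre k e ∧ x ∉ S.pre k e := by
  classical
  by_contra hcon
  have c1 := card_inter_le (S := S) (k := k) h1 (S.pre k e)
  have c2 := card_inter_le (S := S) (k := k) (s := t + 1) (e := e) (by omega) (S.pre k e)
  rw [Finset.disjoint_iff_inter_eq_empty.1 hd, Finset.card_empty] at c1
  rw [Finset.inter_self, card_pre hk] at c2
  have c3 := cnt_succ_of_swapsAt (S := S) ⟨x, y, hxy, hy⟩
  have c4 := cnt_add (S := S) (k := k) (a := s) (b := t) (c := t + 1) h1 (by omega)
  have c5 := cnt_add (S := S) (k := k) (a := s) (b := t + 1) (c := e) (by omega) (by omega)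
  have hx : x ∈ S.pre k t := by
    have := hxy.eqs
    rw [mem_pre]
    omega
  have c6 : (S.pre k (t + 1) ∩ S.pre k e).card ≤ (S.pre k t ∩ S.pre k e).card := by
    rw [pre_succ_of_crosses hxy hy]
    by_cases hx' : x ∈ S.pre k e
    · have hmem : x ∈ S.pre k t ∩ S.pre k e := Finset.mem_inter.2 ⟨hx, hx'⟩
      rw [← Finset.card_erase_add_one hmem]
      refine (Finset.card_le_card ?_).trans (Finset.card_insert_le y _)
      intro z
      simp only [Finset.mem_inter, Finset.mem_insert, Finset.mem_erase]
      tauto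
    · have hy' : y ∉ S.pre k e := fun h => hcon ⟨h, hx'⟩
      refine Finset.card_le_card ?_
      intro z
      simp only [Finset.mem_inter, Finset.mem_insert, Finset.mem_erase]
      rintro ⟨rfl | ⟨-, h⟩, h'⟩
      · exact absurd h' hy'
      · exact ⟨h, h'⟩
  omega

theorem pos_eq_of_pre_eq {t t' : ℤ} (h1 : S.pre k t = S.pre k t')
    (h2 : S.pre (k + 1) t = S.pre (k + 1) t') {z : α} (hz : S.pos t z = k) : S.pos t' z = k := by
  have h3 : z ∉ S.pre k t := by simp [hz]
  have h4 : z ∈ S.pre (k + 1) t := by simp [hz]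
  rw [h1, mem_pre] at h3
  rw [h2, mem_pre] at h4
  omega

/-- Between two consecutive exchanges of the positions `k - 1` and `k` that renew the first `k`
positions, the old element in position `k` has to be replaced by a new one, which takes an exchange
of the positions `k` and `k + 1`. -/
theorem le_cnt_succ (hk : k ≤ n) (hse : s ≤ e) (hd : Disjoint (S.pre k s) (S.pre k e))
    (hc : S.cnt k s e ≤ k) : k ≤ S.cnt (k + 1) s e + 1 := by
  refine (le_cnt_of_disjoint hk hse hd).trans ?_
  suffices h : ∀ t, s ≤ t → t ≤ e → S.cnt k s t ≤ S.cnt (k + 1) s t + 1 ∧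
      ((∃ z ∈ S.pre k e, S.pos t z = k) → S.cnt k s t ≤ S.cnt (k + 1) s t) from
    (h e hse le_rfl).1
  intro t hst
  induction t, hst using Int.leInduction with
  | base => simp [cnt_self]
  | succ t hst ih =>
    intro hte
    obtain ⟨ih1, ih2⟩ := ih (by omega)
    rw [← cnt_add hst (by omega : t ≤ t + 1), ← cnt_add hst (by omega : t ≤ t + 1)]
    by_cases h1 : S.SwapsAt k t
    · rw [cnt_succ_of_swapsAt h1]
      obtain ⟨x, y, hxy, hy⟩ := h1
      obtain ⟨h3, h4⟩ := crosses_of_cnt_le hk hd hc hst (by omega) hxy hy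
      have h5 := ih2 ⟨y, h3, hy⟩
      refine ⟨by omega, ?_⟩
      rintro ⟨z, hz, hz'⟩
      have := hxy.eqs
      have : z = x := S.inj (t + 1) (by omega)
      subst this
      exact absurd hz h4
    · rw [cnt_succ_of_not_swapsAt h1]
      by_cases h2 : S.SwapsAt (k + 1) t
      · rw [cnt_succ_of_swapsAt h2]
        omega
      · rw [cnt_succ_of_not_swapsAt h2]
        refine ⟨by omega, ?_⟩
        rintro ⟨z, hz, hz'⟩
        exact ih2 ⟨z, hz, pos_eq_of_pre_eq (pre_succ_of_not_swapsAt h1)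
          (pre_succ_of_not_swapsAt h2) hz'⟩

end Exchange

end Sweep

/-! ### Renewals of the first positions -/

namespace Sweep

variable {n M : ℕ} {α : Type*} {S : Sweep n M α}

/-- The elements `x` and `y` exchange the positions `j - 1` and `j` at some time. -/
def MeetAt (S : Sweep n M α) (x y : α) (j : ℕ) : Prop :=
  ∃ t, (S.Crosses t x y ∧ S.pos t y = j) ∨ (S.Crosses t y x ∧ S.pos t x = j)

/-- A pair of elements only meets in two places, which are mirror images of each other. -/
theorem MeetAt.eq_or_add_eq {x y : α} {j j' : ℕ} (h : S.MeetAt x y j) (h' : S.MeetAt x y j') :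
    j = j' ∨ j + j' = n := by
  obtain ⟨t, ⟨h1, h2⟩ | ⟨h1, h2⟩⟩ := h <;> obtain ⟨t', ⟨h3, h4⟩ | ⟨h3, h4⟩⟩ := h'
  · left; rw [← h2, ← h4, h1.pos_eq h3]
  · right; rw [← h2, ← h4, h1.pos_add h3]
  · right; rw [← h2, ← h4, h1.pos_add h3]
  · left; rw [← h2, ← h4, h1.pos_eq h3]

namespace Hull

variable [Fintype α] (H : S.Hull)

/-- The first `k` positions are renewed three times in a full period, each time by `k` exchanges:
the `i`-th renewal starts when `u (i + 1)` enters and ends when `u i` exits, and nothing changes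
between the renewals. -/
structure Renews (k : ℕ) : Prop where
  cnt_le : ∀ i, S.cnt k (H.enter k i) (H.exit k i + 1) ≤ k
  gap : ∀ i t, H.exit k i < t → t < H.enter k (i + 1) → ¬ S.SwapsAt k t
  disjoint : ∀ i, Disjoint (S.pre k (H.enter k i)) (S.pre k (H.enter k (i + 1)))

variable {H} {k : ℕ}

theorem Renews.pre_eq (hr : H.Renews k) {i t : ℤ}
    (h1 : H.exit k i < t) (h2 : t ≤ H.enter k (i + 1)) :
    S.pre k t = S.pre k (H.enter k (i + 1)) :=
  (pre_eq_of_not_swapsAt h2 fun t' h3 h4 => hr.gap i t' (by omega) h4).symm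

theorem Renews.pre_exit (hr : H.Renews k) (hk : 1 ≤ k) (hkn : k + 2 ≤ n) (i : ℤ) :
    S.pre k (H.exit k i + 1) = S.pre k (H.enter k (i + 1)) :=
  hr.pre_eq (by omega) (H.exit_lt_enter hk hkn i)

/-- An element brought in by the `i`-th renewal meets `u i` during it. -/
theorem Renews.meetAt_of_new (hr : H.Renews k) (hk : 1 ≤ k) (hkn : k + 2 ≤ n) {i : ℤ} {v : α}
    (hv : v ∈ S.pre k (H.enter k (i + 1))) : ∃ j ≤ k, S.MeetAt v (H.u i) j := by
  have hx := H.exit_spec hk (by omega) i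
  have hee := H.enter_le_exit hk (by omega) i
  have hprev := H.exit_lt_enter hk hkn (i - 1)
  have hprev' := H.enter_le_exit hk (by omega) (i - 1)
  have hin : ∀ t, H.enter k i ≤ t → t ≤ H.exit k i → S.pos t (H.u i) < k := by
    intro t h1 h2
    rw [sub_add_cancel] at hprev
    have := H.pos_lt_of_mem hk (by omega) (i := i - 1) (t := t) (by omega)
      (by rw [sub_add_cancel]; exact h2)
    rwa [sub_add_cancel] at this
  have hv0 : ¬ S.pos (H.enter k i) v < k := fun h =>
    Finset.disjoint_left.1 (hr.disjoint i) (mem_pre.2 h) hv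
  rw [← hr.pre_exit hk hkn, mem_pre] at hv
  have := hin _ le_rfl hee
  obtain ⟨t, h1, h2, h3⟩ := exists_crosses_between (S := S) (s := H.enter k i)
    (e := H.exit k i + 1) (x := H.u i) (y := v) (by omega) (by omega) (by omega)
  have := hin t h1 (by omega)
  have := h3.eqs
  exact ⟨_, by omega, t, Or.inr ⟨h3, rfl⟩⟩

/-- An element thrown out by the `i`-th renewal meets `u (i + 1)` during it. -/
theorem Renews.meetAt_of_old (hr : H.Renews k) (hk : 1 ≤ k) (hkn : k + 2 ≤ n) {i : ℤ} {v : α}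
    (hv : v ∈ S.pre k (H.enter k i)) : ∃ j ≤ k, S.MeetAt v (H.u (i + 1)) j := by
  have he := H.enter_spec hk (by omega) i
  have hee := H.enter_le_exit hk (by omega) i
  have hnext := H.exit_lt_enter hk hkn i
  have hnext' := H.enter_le_exit hk (by omega) (i + 1)
  have hv0 : ¬ S.pos (H.exit k i + 1) v < k := fun h =>
    Finset.disjoint_left.1 (hr.disjoint i) hv (by rwa [← hr.pre_exit hk hkn, mem_pre])
  rw [mem_pre] at hv
  have := H.pos_lt_of_mem hk (by omega) (i := i) (t := H.exit k i + 1) (by omega) (by omega)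
  obtain ⟨t, h1, h2, h3⟩ := exists_crosses_between (S := S) (s := H.enter k i)
    (e := H.exit k i + 1) (x := v) (y := H.u (i + 1)) (by omega) (by omega) (by omega)
  have := H.pos_lt_of_mem hk (by omega) (i := i) (t := t + 1) (by omega) (by omega)
  have := h3.eqs
  exact ⟨_, by omega, t, Or.inl ⟨h3, rfl⟩⟩

variable (H) in
theorem renews_one (hn : 3 ≤ n) : H.Renews 1 := by
  have hen : ∀ i, H.enter 1 i = H.T i := by
    intro i
    have e := H.enter_spec (k := 1) le_rfl (by omega) i
    have x := H.exit_spec (k := 1) le_rfl (by omega) (i + 1)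
    have := H.T_lt i
    by_contra h
    have h1 := H.pos_lt_of_mem (k := 1) le_rfl (by omega) (i := i) (t := H.T i) (by omega)
      (by omega)
    exact H.u_ne i (S.inj (H.T i) (by rw [H.first_end]; omega))
  have hex : ∀ i, H.exit 1 i = H.T i := by
    intro i
    have e := H.enter_spec (k := 1) le_rfl (by omega) (i - 1)
    have x := H.exit_spec (k := 1) le_rfl (by omega) i
    have := H.T_lt (i - 1)
    rw [sub_add_cancel] at this
    by_contra h
    have h1 := H.pos_lt_of_mem (k := 1) le_rfl (by omega) (i := i - 1) (t := H.T i + 1) (by omega)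
      (by rw [sub_add_cancel]; omega)
    rw [sub_add_cancel] at h1
    exact H.u_ne i (S.inj (H.T i + 1) (by rw [H.first_start]; omega))
  have hpre : ∀ i x, x ∈ S.pre 1 (H.T i) → x = H.u i := by
    intro i x hx
    rw [mem_pre] at hx
    exact S.inj (H.T i) (by rw [H.first_end]; omega)
  refine ⟨fun i => ?_, fun i t h1 h2 => ?_, fun i => ?_⟩
  · rw [hen, hex, cnt_succ_of_swapsAt]
    have := H.swapsAt_enter (k := 1) le_rfl (by omega) i
    rwa [hen] at this
  · rw [hex] at h1
    rw [hen] at h2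
    exact H.not_swapsAt_one h1 h2
  · rw [hen, hen, Finset.disjoint_left]
    intro x hx hx'
    exact H.u_ne i ((hpre _ _ hx).symm.trans (hpre _ _ hx'))

/-- Every renewal of the first `k + 1` positions takes at least `k + 1` exchanges: `k - 1` of them
between those for the first `k` positions, and the passages of `u (i + 1)` and `u i`. So the bound on
their total number leaves room for no others. -/
theorem Renews.succ (hr : H.Renews k) (hk : 1 ≤ k) (hkn : 3 * (k + 1) ≤ n)
    (hcnt : ∀ s, S.cnt (k + 1) s (s + 2 * M) ≤ 3 * (k + 1)) : H.Renews (k + 1) := by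
  have hwin : ∀ i, k + 1 ≤ S.cnt (k + 1) (H.enter (k + 1) i) (H.exit (k + 1) i + 1) := by
    intro i
    have h1 := H.enter_succ_lt hk (by omega) i
    have h2 := H.enter_le_exit hk (by omega) i
    have h3 := H.exit_lt_succ hk (by omega) i
    have h4 := le_cnt_succ (S := S) (k := k) (s := H.enter k i) (e := H.exit k i + 1) (by omega)
      (by omega) (by rw [hr.pre_exit hk (by omega)]; exact hr.disjoint i) (hr.cnt_le i)
    have c1 := cnt_succ_of_swapsAt (H.swapsAt_enter (k := k + 1) (by omega) (by omega) i)
    have c2 := cnt_succ_of_swapsAt (H.swapsAt_exit (k := k + 1) (by omega) (by omega) i)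
    rw [← cnt_add (b := H.enter (k + 1) i + 1) (by omega) (by omega),
      ← cnt_add (a := H.enter (k + 1) i + 1) (b := H.enter k i) (by omega) (by omega),
      ← cnt_add (a := H.enter k i) (b := H.exit k i + 1) (by omega) (by omega),
      ← cnt_add (a := H.exit k i + 1) (b := H.exit (k + 1) i) (by omega) (by omega)]
    omega
  have hle : ∀ i, H.enter (k + 1) i ≤ H.exit (k + 1) i := fun i =>
    H.enter_le_exit (by omega) (by omega) i
  have hlt : ∀ i, H.exit (k + 1) i < H.enter (k + 1) (i + 1) := fun i =>
    H.exit_lt_enter (by omega) (by omega) i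
  have hgapcnt : ∀ i, S.cnt (k + 1) (H.enter (k + 1) i) (H.exit (k + 1) i + 1) ≤ k + 1 ∧
      S.cnt (k + 1) (H.exit (k + 1) i + 1) (H.enter (k + 1) (i + 1)) = 0 := by
    intro i
    have a0 := hcnt (H.enter (k + 1) i)
    have p := H.enter_period (k := k + 1) (by omega) (by omega) i
    rw [← p, show i + 3 = i + 1 + 1 + 1 by ring] at a0
    have split : ∀ i, S.cnt (k + 1) (H.enter (k + 1) i) (H.enter (k + 1) (i + 1)) =
        S.cnt (k + 1) (H.enter (k + 1) i) (H.exit (k + 1) i + 1) +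
        S.cnt (k + 1) (H.exit (k + 1) i + 1) (H.enter (k + 1) (i + 1)) := fun i =>
      (cnt_add (by have := hle i; omega) (hlt i)).symm
    have l0 := hle i
    have l1 := hle (i + 1)
    have l2 := hle (i + 1 + 1)
    have g0 := hlt i
    have g1 := hlt (i + 1)
    have g2 := hlt (i + 1 + 1)
    rw [← cnt_add (b := H.enter (k + 1) (i + 1)) (by omega) (by omega),
      ← cnt_add (a := H.enter (k + 1) (i + 1)) (b := H.enter (k + 1) (i + 1 + 1)) (by omega)
      (by omega), split, split, split] at a0
    have := hwin i
    have := hwin (i + 1)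
    have := hwin (i + 1 + 1)
    omega
  have hgap : ∀ i t, H.exit (k + 1) i < t → t < H.enter (k + 1) (i + 1) → ¬ S.SwapsAt (k + 1) t :=
    fun i t h1 h2 => not_swapsAt_of_cnt_eq_zero (hgapcnt i).2 h1 h2
  -- The gap between two renewals shrinks as `k` grows.
  have hpre : ∀ i t, H.exit (k + 1) i < t → t ≤ H.enter (k + 1) (i + 1) →
      S.pre k t = S.pre k (H.enter k (i + 1)) := by
    intro i t h1 h2
    have h3 := H.enter_succ_lt hk (by omega) (i + 1)
    have h4 := H.exit_lt_succ hk (by omega) i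
    exact hr.pre_eq (by omega) (by omega)
  have hpre1 : ∀ i, S.pre (k + 1) (H.exit (k + 1) i + 1) =
      S.pre (k + 1) (H.enter (k + 1) (i + 1)) := fun i =>
    (pre_eq_of_not_swapsAt (hlt i) fun t h1 h2 => hgap i t h1 h2).symm
  -- The additional element meets `u (i + 1)` when it is thrown out, and `u i` when it comes in.
  have hold : ∀ i x, S.pos (H.enter (k + 1) i) x = k →
      ∃ t, S.Crosses t x (H.u (i + 1)) ∧ S.pos t (H.u (i + 1)) = k + 1 := by
    intro i x hx
    have e := H.enter_spec (k := k + 1) (by omega) (by omega) i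
    obtain ⟨y, hy⟩ := H.crosses_enter (k := k + 1) (by omega) (by omega) i
    have := hy.eqs
    have : y = x := S.inj (H.enter (k + 1) i) (by omega)
    subst this
    exact ⟨_, hy, e.2.2.1⟩
  have hnew : ∀ i x, S.pos (H.enter (k + 1) (i + 1)) x = k →
      ∃ t, S.Crosses t (H.u i) x ∧ S.pos t x = k + 1 := by
    intro i x hx
    have e := H.exit_spec (k := k + 1) (by omega) (by omega) i
    obtain ⟨y, hy⟩ := H.crosses_exit (k := k + 1) (by omega) (by omega) i
    have e2 := hy.eqs
    have h1 : S.pos (H.enter (k + 1) (i + 1)) y = k := by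
      refine pos_eq_of_pre_eq ?_ (hpre1 i) (by omega)
      rw [hpre i _ (by omega) (hlt i), hpre i _ (hlt i) le_rfl]
    have : y = x := S.inj _ (h1.trans hx.symm)
    subst this
    exact ⟨_, hy, by omega⟩
  have hmem : ∀ i x, x ∈ S.pre (k + 1) (H.enter (k + 1) (i + 1)) →
      x ∈ S.pre k (H.enter k (i + 1)) ∨ S.pos (H.enter (k + 1) (i + 1)) x = k := by
    intro i x hx
    rw [← hpre i _ (hlt i) le_rfl, mem_pre]
    rw [mem_pre] at hx
    omega
  have hdisj : ∀ i, Disjoint (S.pre (k + 1) (H.enter (k + 1) (i + 1)))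
      (S.pre (k + 1) (H.enter (k + 1) (i + 1 + 1))) := by
    intro i
    have hu : H.u (i + 1 + 1 + 1) = H.u i := by
      rw [show i + 1 + 1 + 1 = i + 3 by ring, H.u_period]
    rw [Finset.disjoint_left]
    intro x hx hx'
    rcases hmem _ _ hx with h | h <;> rcases hmem _ _ hx' with h' | h'
    · exact Finset.disjoint_left.1 (hr.disjoint (i + 1)) h h'
    · obtain ⟨j, hj, hm⟩ := hr.meetAt_of_new hk (by omega) h
      obtain ⟨t, ht⟩ := hold _ _ h'
      rw [hu] at ht
      have := hm.eq_or_add_eq ⟨t, Or.inl ht⟩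
      omega
    · obtain ⟨j, hj, hm⟩ := hr.meetAt_of_old hk (by omega) h'
      rw [hu] at hm
      obtain ⟨t, ht⟩ := hnew _ _ h
      have := hm.eq_or_add_eq ⟨t, Or.inr ht⟩
      omega
    · obtain ⟨t, ht, ht'⟩ := hold _ _ h'
      rw [hu] at ht ht'
      obtain ⟨t', hs, hs'⟩ := hnew _ _ h
      have := hs.pos_add ht
      omega
  refine ⟨fun i => (hgapcnt i).1, hgap, fun i => ?_⟩
  have := hdisj (i - 1)
  rwa [sub_add_cancel] at this

variable (H) in
theorem renews {m : ℕ} (hn : n = 3 * m)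
    (hcnt : ∀ k, 1 ≤ k → k ≤ m → ∀ s, S.cnt k s (s + 2 * M) ≤ 3 * k) {k : ℕ} (hk : 1 ≤ k)
    (hkm : k ≤ m) : H.Renews k := by
  induction k, hk using Nat.le_induction with
  | base => exact H.renews_one (by omega)
  | succ k hk ih => exact (ih (by omega)).succ hk (by omega) (hcnt _ (by omega) hkm)

theorem Renews.mem_pre_or {m : ℕ} (hr : H.Renews m) (hn : n = 3 * m) (hm : 1 ≤ m) (i : ℤ) (x : α) :
    x ∈ S.pre m (H.enter m i) ∨ x ∈ S.pre m (H.enter m (i + 1)) ∨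
      x ∈ S.pre m (H.enter m (i + 2)) := by
  classical
  have hu : S.pre m (H.enter m i) ∪ S.pre m (H.enter m (i + 1)) ∪ S.pre m (H.enter m (i + 2)) =
      Finset.univ := by
    have huniv : S.pre n 0 = Finset.univ := Finset.eq_univ_of_forall fun x =>
      mem_pre.2 (S.pos_lt 0 x)
    have d1 := hr.disjoint i
    have d2 := hr.disjoint (i + 1)
    have d3 := hr.disjoint (i + 1 + 1)
    rw [show i + 1 + 1 + 1 = i + 3 by ring, H.enter_period hm (by omega), pre_period] at d3
    rw [show i + 1 + 1 = i + 2 by ring] at d2 d3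
    rw [← Finset.card_eq_iff_eq_univ, ← Finset.card_univ, ← huniv, card_pre le_rfl,
      Finset.card_union_of_disjoint (Finset.disjoint_union_left.2 ⟨d3.symm, d2⟩),
      Finset.card_union_of_disjoint d1, card_pre (by omega), card_pre (by omega),
      card_pre (by omega)]
    omega
  have := hu ▸ Finset.mem_univ x
  rwa [Finset.mem_union, Finset.mem_union, or_assoc] at this
/-- While the first third is renewed for the `i`-th time, the last third consists of the elements
that the next renewal brings in. -/
theorem Renews.mem_pre_iff_last {m : ℕ} (hr : H.Renews m) (hn : n = 3 * m) (hm : 1 ≤ m) {i t : ℤ}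
    (h1 : H.enter m i ≤ t) (h2 : t ≤ H.exit m i + 1) (x : α) :
    x ∈ S.pre m (H.enter m (i + 2)) ↔ 2 * m ≤ S.pos t x := by
  have hM := half_period_pos S (by omega)
  have e := H.enter_spec hm (by omega) i
  have x1 := H.exit_spec hm (by omega) i
  have hee := H.enter_le_exit hm (by omega) i
  have g := H.exit_lt_enter hm (by omega) i
  have g' := H.exit_lt_enter hm (by omega) (i - 1)
  have hee' := H.enter_le_exit hm (by omega) (i + 1)
  have hee'' := H.enter_le_exit hm (by omega) (i - 1)
  have xp := Hull.exit_period (H := H) hm (by omega) i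
  rw [sub_add_cancel] at g'
  -- Both `u i` and `u (i + 1)` are among the first `m + 1` elements, hence not in the last third.
  have p1 : S.pos t (H.u (i + 1)) ≤ m := by
    rcases h1.eq_or_lt with rfl | h
    · omega
    · exact (H.pos_lt_of_mem hm (by omega) h (by omega)).le
  have p2 : S.pos t (H.u i) ≤ m := by
    rcases h2.eq_or_lt with rfl | h
    · omega
    · have := H.pos_lt_of_mem hm (by omega) (i := i - 1) (t := t) (by omega)
        (by rw [sub_add_cancel]; omega)
      rw [sub_add_cancel] at this
      exact this.le
  have r1 := S.reverse t (H.u i)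
  have r2 := S.reverse t (H.u (i + 1))
  have h3 : H.exit m (i + 1) < t + M := by
    by_contra h
    have := H.pos_lt_of_mem hm (by omega) (i := i) (t := t + M) (by omega) (by omega)
    omega
  have h4 : t + M ≤ H.enter m (i + 2) := by
    by_contra h
    have := H.pos_lt_of_mem hm (by omega) (i := i + 2) (t := t + M) (by omega)
      (by rw [show i + 2 + 1 = i + 3 by ring]; omega)
    rw [show i + 2 + 1 = i + 3 by ring, H.u_period] at this
    omega
  rw [show i + 2 = i + 1 + 1 by ring] at h4 ⊢
  rw [← hr.pre_eq h3 h4, mem_pre]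
  have := S.reverse t x
  omega

end Hull

/-- If the positions `k - 1` and `k` are exchanged at most `3 * k` times in every full period, for
all `k ≤ n / 3`, then the elements split into three sets `Q i` of the same size that renew each
other cyclically in the first third of the positions. While `Q (i + 1)` replaces `Q i` there, from
time `a i` to time `b i`, the set `Q (i + 2)` stays in the last third. -/
theorem exists_three_blocks [Fintype α] (S : Sweep n M α) {m : ℕ} (hn : n = 3 * m) (hm : 1 ≤ m)
    (hcnt : ∀ k, 1 ≤ k → k ≤ m → ∀ s, S.cnt k s (s + 2 * M) ≤ 3 * k) :
    ∃ (Q : ℤ → Finset α) (a b : ℤ → ℤ),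
      (∀ i, Q (i + 3) = Q i) ∧ (∀ i, Disjoint (Q i) (Q (i + 1))) ∧ (∀ i, a i ≤ b i) ∧
      (∀ i x, x ∈ Q i ↔ S.pos (a i) x < m) ∧
      (∀ i x, x ∈ Q (i + 1) ↔ m ≤ S.pos (a i) x ∧ S.pos (a i) x < 2 * m) ∧
      (∀ i x, x ∈ Q (i + 1) ↔ S.pos (b i) x < m) ∧
      ∀ i t x, a i ≤ t → t ≤ b i → (x ∈ Q (i + 2) ↔ 2 * m ≤ S.pos t x) := by
  obtain ⟨H⟩ := exists_hull (S := S) (by omega) (hcnt 1 le_rfl hm)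
  have hr := H.renews hn hcnt hm le_rfl
  have hle : ∀ i, H.enter m i ≤ H.exit m i := H.enter_le_exit hm (by omega)
  refine ⟨fun i => S.pre m (H.enter m i), H.enter m, fun i => H.exit m i + 1, fun i => ?_,
    hr.disjoint, fun i => (hle i).trans (Int.le_add_one le_rfl), fun i x => mem_pre, fun i x => ?_,
    fun i x => ?_, fun i t x h1 h2 => hr.mem_pre_iff_last hn hm h1 h2 x⟩
  · dsimp only
    rw [H.enter_period hm (by omega), pre_period]
  · have h1 := hr.mem_pre_or hn hm i x
    have h2 : x ∈ S.pre m (H.enter m i) → _ := fun h => Finset.disjoint_left.1 (hr.disjoint i) h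
    have h3 : x ∈ S.pre m (H.enter m (i + 1)) → _ := fun h =>
      Finset.disjoint_left.1 (hr.disjoint (i + 1)) h
    have hle' := (hle i).trans (Int.le_add_one le_rfl)
    rw [show i + 1 + 1 = i + 2 by ring, hr.mem_pre_iff_last hn hm le_rfl hle'] at h3
    rw [hr.mem_pre_iff_last hn hm le_rfl hle', mem_pre] at h1
    rw [mem_pre] at h2
    constructor
    · intro h
      have h4 := mt h2 (not_not.2 h)
      have h5 := h3 h
      omega
    · rintro ⟨h4, h5⟩
      rcases h1 with h | h | h
      · omega
      · exact h
      · omega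
  · dsimp only
    rw [← hr.pre_exit hm (by omega), mem_pre]

end Sweep

/-! ### Allowable sequences -/

namespace Sweep

variable {n M : ℕ} {α : Type*} {S : Sweep n M α}

theorem SwapsAt.shift {k : ℕ} {t : ℤ} (h : S.SwapsAt k t) : S.SwapsAt (n - k) (t + M) := by
  obtain ⟨x, y, hxy, hy⟩ := h
  refine ⟨y, x, hxy.shift, ?_⟩
  have := hxy.eqs
  have := S.reverse t x
  omega

theorem SwapsAt.shift_mul {k : ℕ} {t : ℤ} (h : S.SwapsAt k t) (z : ℤ) :
    S.SwapsAt k (t + M * z) ∨ S.SwapsAt (n - k) (t + M * z) := by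
  have hp : ∀ {k t} (w : ℤ), S.SwapsAt k t → S.SwapsAt k (t + 2 * M * w) := by
    rintro k t w ⟨x, y, hxy, hy⟩
    exact ⟨x, y, crosses_period_mul.2 hxy, by rwa [pos_period_mul]⟩
  rcases Int.even_or_odd' z with ⟨w, rfl | rfl⟩
  · left
    have := hp w h
    rwa [show t + 2 * (M : ℤ) * w = t + M * (2 * w) by ring] at this
  · right
    have := hp w h.shift
    rwa [show t + M + 2 * (M : ℤ) * w = t + M * (2 * w + 1) by ring] at this

theorem Crosses.of_half_period {s t : ℤ} {x y : α} (hs : S.pos s x < S.pos s y) (h1 : s ≤ t)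
    (h2 : t < s + M) (h : S.Crosses t x y ∨ S.Crosses t y x) : S.Crosses t x y := by
  rcases h with h | h
  · exact h
  · obtain ⟨t', h3, h4, h5⟩ := exists_crosses_between h1 hs h.1
    exact (not_crosses_of_lt h5 (Or.inr h) h4 (by omega)).elim

end Sweep

namespace AllowableSequence

variable {n : ℕ} {α : Type*} (S : AllowableSequence n α)

theorem symm_perm_succ {t : ℤ} {p q : Fin n}
    (h : S.perm (t + 1) = (Equiv.swap p q).trans (S.perm t))
    (x : α) : (S.perm (t + 1)).symm x = Equiv.swap p q ((S.perm t).symm x) := by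
  rw [h]
  simp

theorem two_le (S : AllowableSequence n α) : 2 ≤ n := by
  obtain ⟨p, q, hpq, -⟩ := S.step 0
  omega

theorem symm_perm_reverse (t : ℤ) (x : α) :
    (S.perm (t + (n.choose 2 : ℕ))).symm x = ((S.perm t).symm x).rev := by
  rw [Equiv.symm_apply_eq, S.reverse]
  simp

/-- The elements that change their position at time `t`. -/
def moved [Fintype α] (t : ℤ) : Finset α := by
  classical
  exact Finset.univ.filter fun x => (S.perm (t + 1)).symm x ≠ (S.perm t).symm x

theorem mem_moved [Fintype α] {t : ℤ} {x : α} :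
    x ∈ S.moved t ↔ (S.perm (t + 1)).symm x ≠ (S.perm t).symm x := by
  classical
  simp [moved]

theorem card_moved [Fintype α] (t : ℤ) : (S.moved t).card = 2 := by
  classical
  obtain ⟨p, q, hpq, h⟩ := S.step t
  have hne : p ≠ q := by
    rintro rfl
    omega
  have : S.moved t = {S.perm t p, S.perm t q} := by
    ext x
    rw [mem_moved, S.symm_perm_succ h, Finset.mem_insert, Finset.mem_singleton,
      ← Equiv.symm_apply_eq, ← Equiv.symm_apply_eq]
    rcases eq_or_ne ((S.perm t).symm x) p with h1 | h1
    · simp [h1, hne.symm]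
    rcases eq_or_ne ((S.perm t).symm x) q with h2 | h2
    · simp [h2, hne]
    · simp [h1, h2, Equiv.swap_apply_of_ne_of_ne h1 h2]
  rw [this, Finset.card_pair fun h => hne ((S.perm t).injective h)]

theorem moved_add_choose [Fintype α] (t : ℤ) : S.moved (t + (n.choose 2 : ℕ)) = S.moved t := by
  ext x
  rw [mem_moved, mem_moved, add_right_comm, symm_perm_reverse, symm_perm_reverse, ne_eq,
    Fin.rev_inj]

theorem moved_add_choose_mul [Fintype α] (t z : ℤ) :
    S.moved (t + (n.choose 2 : ℕ) * z) = S.moved t := by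
  induction z using Int.induction_on with
  | zero => simp
  | succ i ih => rw [← ih, ← S.moved_add_choose (t + _ * (i : ℤ))]; congr 1; ring
  | pred i ih => rw [← ih, ← S.moved_add_choose (t + _ * (-(i : ℤ) - 1))]; congr 1; ring

theorem pos_step (t : ℤ) (x : α) :
    (((S.perm (t + 1)).symm x : Fin n) : ℕ) ≤ ((S.perm t).symm x : Fin n) + 1 ∧
    (((S.perm t).symm x : Fin n) : ℕ) ≤ ((S.perm (t + 1)).symm x : Fin n) + 1 := by
  obtain ⟨p, q, hpq, h⟩ := S.step t
  rw [S.symm_perm_succ h, Equiv.swap_apply_def]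
  split_ifs with h1 h2
  · rw [h1]; omega
  · rw [h2]; omega
  · omega

/-- Every two elements have to be transposed in a half-period, which has only as many steps as there
are pairs: so different steps of a half-period transpose different pairs. -/
theorem moved_injOn [Fintype α] (s : ℤ) :
    Set.InjOn S.moved (Finset.Ico s (s + (n.choose 2 : ℕ)) : Finset ℤ) := by
  classical
  have hcard : Fintype.card α = n := by
    rw [← Fintype.card_fin n]
    exact (Fintype.card_congr (S.perm 0)).symm
  have key : ∀ x y : α, (S.perm s).symm x < (S.perm s).symm y →
      ∃ t ∈ Finset.Ico s (s + (n.choose 2 : ℕ)), S.moved t = {x, y} := by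
    intro x y hxy
    have hne : x ≠ y := by
      rintro rfl
      exact lt_irrefl _ hxy
    have r1 := congrArg Fin.val (S.symm_perm_reverse s x)
    have r2 := congrArg Fin.val (S.symm_perm_reverse s y)
    rw [Fin.val_rev] at r1 r2
    rw [Fin.lt_def] at hxy
    obtain ⟨t, h1, h2, h3, h4⟩ := exists_order_flip
      (f := fun t => (((S.perm t).symm x : Fin n) : ℕ))
      (g := fun t => (((S.perm t).symm y : Fin n) : ℕ)) (s := s) (e := s + (n.choose 2 : ℕ))
      (by omega) (fun t h => hne ((S.perm t).symm.injective (Fin.ext h))) hxy (by omega)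
    have s1 := S.pos_step t x
    have s2 := S.pos_step t y
    refine ⟨t, Finset.mem_Ico.2 ⟨h1, h2⟩, (Finset.eq_of_subset_of_card_le ?_ ?_).symm⟩
    · intro z hz
      rw [Finset.mem_insert, Finset.mem_singleton] at hz
      rw [mem_moved, ne_eq, Fin.ext_iff]
      rcases hz with rfl | rfl <;> omega
    · rw [card_moved, Finset.card_pair hne]
  refine Finset.injOn_of_surjOn_of_card_le (t := Finset.univ.powersetCard 2) S.moved ?_ ?_ ?_
  · intro t _
    simp [Finset.mem_powersetCard, card_moved]
  · intro e he
    rw [Finset.mem_coe, Finset.mem_powersetCard, Finset.card_eq_two] at he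
    obtain ⟨-, x, y, hxy, rfl⟩ := he
    rcases lt_or_gt_of_ne fun h => hxy ((S.perm s).symm.injective h) with h | h
    · obtain ⟨t, ht, ht'⟩ := key x y h
      exact ⟨t, ht, ht'⟩
    · obtain ⟨t, ht, ht'⟩ := key y x h
      exact ⟨t, ht, by rw [ht', Finset.pair_comm]⟩
  · rw [Finset.card_powersetCard, Finset.card_univ, hcard, Int.card_Ico]
    omega

theorem choose_dvd_of_moved_eq [Fintype α] {t t' : ℤ} (h : S.moved t = S.moved t') :
    ((n.choose 2 : ℕ) : ℤ) ∣ t' - t := by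
  have hN : 0 < n.choose 2 := Nat.choose_pos S.two_le
  have hN' : (0 : ℤ) < (n.choose 2 : ℕ) := by exact_mod_cast hN
  have h1 := Int.emod_nonneg (t' - t) hN'.ne'
  have h2 := Int.emod_lt_of_pos (t' - t) hN'
  have h3 := Int.emod_add_mul_ediv (t' - t) (n.choose 2 : ℕ)
  rw [Int.dvd_iff_emod_eq_zero]
  have h4 : S.moved (t + (t' - t) % (n.choose 2 : ℕ)) = S.moved t := by
    rw [h, ← S.moved_add_choose_mul _ ((t' - t) / (n.choose 2 : ℕ))]
    congr 1
    linarith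
  have := S.moved_injOn t (by simp; omega) (by simp; omega) h4
  omega

/-- The sweep of an allowable sequence. -/
def toSweep : Sweep n (n.choose 2) α where
  pos t x := ((S.perm t).symm x : Fin n)
  pos_lt t x := Fin.is_lt _
  inj t x y h := (S.perm t).symm.injective (Fin.ext h)
  surj t p hp := ⟨S.perm t ⟨p, hp⟩, by simp⟩
  step_le t x := (S.pos_step t x).1
  le_step t x := (S.pos_step t x).2
  reverse t x := by
    have := congrArg Fin.val (S.symm_perm_reverse t x)
    rw [Fin.val_rev] at this
    omega
  dvd_of_crossings x y t t' h1 h2 h3 h4 := by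
    classical
    let _ : Fintype α := Fintype.ofEquiv _ (S.perm 0)
    have hne : x ≠ y := by
      rintro rfl
      omega
    have key : ∀ t, (((S.perm t).symm x : Fin n) : ℕ) < ((S.perm t).symm y : Fin n) →
        (((S.perm (t + 1)).symm y : Fin n) : ℕ) < ((S.perm (t + 1)).symm x : Fin n) →
        S.moved t = {x, y} := by
      intro t h1 h2
      have s1 := S.pos_step t x
      have s2 := S.pos_step t y
      refine (Finset.eq_of_subset_of_card_le ?_ ?_).symm
      · intro z hz
        rw [Finset.mem_insert, Finset.mem_singleton] at hz
        rw [mem_moved, ne_eq, Fin.ext_iff]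
        rcases hz with rfl | rfl <;> omega
      · rw [card_moved, Finset.card_pair hne]
    exact S.choose_dvd_of_moved_eq ((key t h1 h2).trans (key t' h3 h4).symm)

theorem toSweep_pos (t : ℤ) (x : α) : S.toSweep.pos t x = ((S.perm t).symm x : Fin n) := rfl

variable {S}

theorem crosses_of_transposes {t : ℤ} {x y : α} (h : S.Transposes t x y) :
    S.toSweep.Crosses t x y ∨ S.toSweep.Crosses t y x := by
  classical
  obtain ⟨hne, h⟩ := h
  have hx : S.toSweep.pos (t + 1) x = S.toSweep.pos t y := by
    rw [toSweep_pos, toSweep_pos, h]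
    simp
  have hy : S.toSweep.pos (t + 1) y = S.toSweep.pos t x := by
    rw [toSweep_pos, toSweep_pos, h]
    simp
  unfold Sweep.Crosses
  have : S.toSweep.pos t x ≠ S.toSweep.pos t y := fun h => hne (S.toSweep.inj t h)
  omega

theorem isITransposition_of_swapsAt {k : ℕ} {t : ℤ} (h : S.toSweep.SwapsAt k t) :
    S.IsITransposition t k := by
  obtain ⟨p, q, hpq, hstep⟩ := S.step t
  obtain ⟨x, y, hxy, hy⟩ := h
  have e := hxy.eqs
  simp only [toSweep_pos] at e hy
  have key := S.symm_perm_succ hstep y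
  rw [Equiv.swap_apply_def] at key
  split_ifs at key with h1 h2
  · rw [h1] at e
    rw [key] at e
    omega
  · rw [h2] at hy
    exact ⟨p, q, by omega, hy, hstep⟩
  · rw [key] at e
    omega

theorem IsITransposition.unique {i k : ℕ} {t : ℤ} (h : S.IsITransposition t i)
    (h' : S.IsITransposition t k) : i = k := by
  obtain ⟨p, q, hp, hq, h1⟩ := h
  obtain ⟨p', q', hp', hq', h2⟩ := h'
  have h3 := S.symm_perm_succ h1 (S.perm t p)
  have h4 := S.symm_perm_succ h2 (S.perm t p)
  rw [h3, Equiv.symm_apply_apply, Equiv.swap_apply_left, Equiv.swap_apply_def] at h4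
  split_ifs at h4 with h5 h6
  · rw [h4] at hq
    omega
  · rw [h6] at hp
    rw [h4] at hq
    omega
  · rw [h4] at hq
    omega

theorem choose_two_succ (k : ℕ) : 3 * (k + 1).choose 2 = 3 * k.choose 2 + 3 * k := by
  rw [Nat.choose_succ_succ' k 1, Nat.choose_one_right]
  ring

/-- The exchanges of the positions `k - 1` and `k` in a full period correspond to the `k`-critical
transpositions of a half-period. -/
theorem cnt_toSweep_le {m : ℕ} (hn : n = 3 * m) {s : ℤ}
    (h : ∀ k : ℕ, 3 * k < n → S.numLEKEdges s k = 3 * (k + 2).choose 2) {k : ℕ} (hk : 1 ≤ k)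
    (hkm : k ≤ m) (s' : ℤ) : S.toSweep.cnt k s' (s' + 2 * (n.choose 2 : ℕ)) ≤ 3 * k := by
  classical
  have hN' : (0 : ℤ) < (n.choose 2 : ℕ) := by exact_mod_cast Nat.choose_pos S.two_le
  let F : ℕ → Finset ℕ := fun k => (Finset.range (n.choose 2)).filter
    fun j : ℕ => ∃ i, 1 ≤ i ∧ i ≤ k ∧ S.IsCritical (s + (j : ℤ)) i
  have hF : ∀ k, k ≤ m → (F k).card = 3 * (k + 1).choose 2 := by
    intro k hk
    rcases Nat.eq_zero_or_pos k with rfl | h0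
    · have : F 0 = ∅ := Finset.filter_eq_empty_iff.2 fun j _ => by
        rintro ⟨i, h1, h2, -⟩
        omega
      simp [this]
    · obtain ⟨l, rfl⟩ : ∃ l, k = l + 1 := ⟨k - 1, by omega⟩
      rw [← h l (by omega)]
      unfold numLEKEdges numLECritical
      simp only [F]
  have hsub : F (k - 1) ⊆ F k := by
    intro j
    simp only [F, Finset.mem_filter]
    rintro ⟨h1, i, h2, h3, h4⟩
    exact ⟨h1, i, h2, by omega, h4⟩
  have hcard : (F k \ F (k - 1)).card = 3 * k := by
    rw [Finset.card_sdiff_of_subset hsub, hF k hkm, hF (k - 1) (by omega), choose_two_succ,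
      Nat.sub_add_cancel hk]
    omega
  rw [← hcard]
  unfold Sweep.cnt
  -- The representative of a time in the half-period starting at `s`.
  have hrep : ∀ t : ℤ, s + (((t - s) % (n.choose 2 : ℕ)).toNat : ℤ) =
      t + (n.choose 2 : ℕ) * -((t - s) / (n.choose 2 : ℕ)) := by
    intro t
    rw [Int.toNat_of_nonneg (Int.emod_nonneg _ hN'.ne')]
    have := Int.emod_add_mul_ediv (t - s) (n.choose 2 : ℕ)
    linarith
  refine Finset.card_le_card_of_injOn (fun t => ((t - s) % (n.choose 2 : ℕ)).toNat) ?_ ?_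
  · intro t ht
    rw [Finset.mem_coe, Finset.mem_filter] at ht
    have h1 := Int.emod_nonneg (t - s) hN'.ne'
    have h2 := Int.emod_lt_of_pos (t - s) hN'
    have h3 := ht.2.shift_mul (-((t - s) / (n.choose 2 : ℕ)))
    rw [← hrep] at h3
    have h4 : ((t - s) % (n.choose 2 : ℕ)).toNat ∈ Finset.range (n.choose 2) := by
      rw [Finset.mem_range]
      omega
    rw [Finset.mem_coe, Finset.mem_sdiff]
    simp only [F, Finset.mem_filter]
    refine ⟨⟨h4, k, hk, le_rfl, h3.imp isITransposition_of_swapsAt isITransposition_of_swapsAt⟩, ?_⟩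
    rintro ⟨-, i, h5, h6, h7⟩
    rcases h3 with h3 | h3 <;> rcases h7 with h7 | h7 <;>
    · have := (isITransposition_of_swapsAt h3).unique h7
      omega
  · intro t ht t' ht' htt
    rw [Finset.mem_coe, Finset.mem_filter, Finset.mem_Ico] at ht ht'
    have h1 := Int.emod_nonneg (t - s) hN'.ne'
    have h1' := Int.emod_nonneg (t' - s) hN'.ne'
    have h2 : (t - s) % (n.choose 2 : ℕ) = (t' - s) % (n.choose 2 : ℕ) := by
      simp only at htt
      omega
    have hd : ((n.choose 2 : ℕ) : ℤ) ∣ t' - t := by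
      have := Int.ModEq.dvd h2
      rwa [sub_sub_sub_cancel_right] at this
    obtain ⟨z, hz⟩ := hd
    have key : ∀ {t t' : ℤ}, S.toSweep.SwapsAt k t → S.toSweep.SwapsAt k t' →
        t' = t + (n.choose 2 : ℕ) → False := by
      rintro t t' h h' rfl
      have := (isITransposition_of_swapsAt h.shift).unique (isITransposition_of_swapsAt h')
      omega
    have z1 : z < 2 := by
      by_contra hcon
      have : ((n.choose 2 : ℕ) : ℤ) * 2 ≤ (n.choose 2 : ℕ) * z :=
        mul_le_mul_of_nonneg_left (by omega) hN'.le
      omega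
    have z2 : -2 < z := by
      by_contra hcon
      have : ((n.choose 2 : ℕ) : ℤ) * z ≤ (n.choose 2 : ℕ) * (-2) :=
        mul_le_mul_of_nonneg_left (by omega) hN'.le
      omega
    have : z = -1 ∨ z = 0 ∨ z = 1 := by omega
    rcases this with rfl | rfl | rfl
    · exact (key ht'.2 ht.2 (by linarith)).elim
    · linarith
    · exact (key ht.2 ht'.2 (by linarith)).elim

theorem isThreeDecomposable_of_numLEKEdges (hn : 3 ∣ n) {s : ℤ}
    (h : ∀ k : ℕ, 3 * k < n → S.numLEKEdges s k = 3 * (k + 2).choose 2) :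
    S.IsThreeDecomposable := by
  obtain ⟨m, rfl⟩ := hn
  have h2 := S.two_le
  let _ : Fintype α := Fintype.ofEquiv _ (S.perm 0)
  obtain ⟨Q, a, b, hQ, hd, hab, ha, hmid, hb, hlast⟩ := S.toSweep.exists_three_blocks rfl
    (by omega) fun k hk hkm => cnt_toSweep_le rfl h hk hkm
  have hdis : ∀ i x, x ∈ Q i → x ∉ Q (i + 1) := fun i _ h => Finset.disjoint_left.1 (hd i) h
  -- A crossing of `Q i` and `Q (i + 1)` belongs to the time in which the one replaces the other in
  -- the first third, up to a period.
  have hst : ∀ {i t x y}, x ∈ Q i → y ∈ Q (i + 1) → S.toSweep.Crosses t x y → ∀ z,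
      (z ∈ Q (i + 2) ↔ 2 * m ≤ S.toSweep.pos t z) ∧
      (z ∈ Q (i + 2) ↔ 2 * m ≤ S.toSweep.pos (t + 1) z) := by
    intro i t x y hx hy hxy z
    have h1 := (ha i x).1 hx
    have h2 := (ha i y).not.1 fun h => hdis i y h hy
    have h3 := (hb i x).not.1 (hdis i x hx)
    have h4 := (hb i y).1 hy
    obtain ⟨t', h5, h6, h7⟩ := Sweep.exists_crosses_between (hab i) (by omega : _ < _)
      (by omega : S.toSweep.pos (b i) y < S.toSweep.pos (b i) x)
    obtain ⟨w, rfl⟩ := h7.two_dvd hxy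
    rw [add_right_comm, S.toSweep.pos_period_mul, S.toSweep.pos_period_mul]
    exact ⟨hlast i t' z h5 h6.le, hlast i (t' + 1) z (by omega) h6⟩
  have hst' : ∀ {t x y i}, S.toSweep.pos (a i) x < S.toSweep.pos (a i) y → a i ≤ t →
      t < a i + ((3 * m).choose 2 : ℕ) → S.Transposes t x y → S.toSweep.Crosses t x y :=
    fun h1 h2 h3 h4 => Sweep.Crosses.of_half_period h1 h2 h3 (crosses_of_transposes h4)
  have hA : ∀ x, x ∈ Q 0 ↔ S.toSweep.pos (a 0) x < m := ha 0
  have hC : ∀ x, x ∈ Q 2 ↔ 2 * m ≤ S.toSweep.pos (a 0) x := fun x => hlast 0 _ x le_rfl (hab 0)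
  have hB : ∀ x, x ∈ Q 1 ↔ m ≤ S.toSweep.pos (a 0) x ∧ S.toSweep.pos (a 0) x < 2 * m := hmid 0
  have hdiv : 3 * m / 3 = m := Nat.mul_div_cancel_left m (by omega)
  -- The half-period starts when `Q 1` begins to replace `Q 0` in the first third.
  refine ⟨a 0, Dvd.intro m rfl, Q 0, Q 1, Q 2, fun p => ?_, ?_, ?_⟩
  · have hp : S.toSweep.pos (a 0) (S.perm (a 0) p) = p := by
      rw [toSweep_pos, Equiv.symm_apply_apply]
    rw [hdiv, Finset.mem_coe, Finset.mem_coe, Finset.mem_coe, hA, hB, hC, hp]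
    exact ⟨Iff.rfl, Iff.rfl, Iff.rfl⟩
  · intro t t' h1 h1' h3 h3' x hx y hy z hz w hw hxy hzw
    have hx1 := (hA x).1 hx
    have hy1 := (hB y).1 hy
    have hz1 := (hC z).1 hz
    have hw1 : S.toSweep.pos (a 0) w < 2 * m := by
      rcases hw with hw | hw
      · have := (hA w).1 hw
        omega
      · exact ((hB w).1 hw).2
    have hw2 : w ∉ Q 2 := fun h => by
      have := (hC w).1 h
      omega
    have c1 := hst' (i := 0) (by omega) h1 h1' hxy
    have hzw' : S.Transposes t' w z := ⟨hzw.1.symm, by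
      classical
      rw [hzw.2, Equiv.swap_comm]⟩
    have c2 := hst' (i := 0) (by omega) h3 h3' hzw'
    by_contra hcon
    -- After `t'` the element `z` is in front of `w`, but `Q 2` is behind all others after `t`.
    have l := hst (i := 0) hx hy c1
    have lz := (l z).2.1 hz
    have lw := (l w).2.not.1 hw2
    have hcr : S.toSweep.pos (t + 1) w < S.toSweep.pos (t + 1) z := by omega
    rcases (by omega : t' + 1 ≤ t + 1).eq_or_lt with h | h
    · rw [← h] at hcr
      have := c2.2
      omega
    · obtain ⟨t'', h5, h6, h7⟩ := Sweep.exists_crosses_between h.le c2.2 hcr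
      exact Sweep.not_crosses_of_lt c2 (Or.inr h7) (by omega) (by omega)
  · intro t t' h1 h1' h3 h3' x hx y hy z hz w hw hxz hyw
    have hx1 := (hA x).1 hx
    have hy1 := (hB y).1 hy
    have hz1 := (hC z).1 hz
    have hw1 := (hC w).1 hw
    have c1 := hst' (i := 0) (by omega) h1 h1' hxz
    have c2 := hst' (i := 0) (by omega) h3 h3' hyw
    by_contra hcon
    -- At `t'` the set `Q 0` is already behind all others.
    have l := hst (i := 1) hy hw c2
    have lx := (l x).1.1 (by rw [show (1 : ℤ) + 2 = 0 + 3 by norm_num, hQ]; exact hx)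
    have lz := (l z).1.not.1 (by
      rw [show (1 : ℤ) + 2 = 0 + 3 by norm_num, hQ]
      intro h
      have := (hA z).1 h
      omega)
    obtain ⟨t'', h5, h6, h7⟩ := Sweep.exists_crosses_between (S := S.toSweep) (x := x) (y := z)
      h3 (by omega) (by omega)
    exact Sweep.not_crosses_of_lt h7 (Or.inl c1) (by omega) (by omega)

end AllowableSequence

/-! ### Enumerations and ranks -/

open Real in
/-- A set of reals that is invariant under translation by `π`, and that is finite and nonempty in
`[0, π)`, can be enumerated increasingly. -/
theorem exists_enumeration_of_periodic {Z : Set ℝ} (hper : ∀ x (z : ℤ), x ∈ Z → x + z * π ∈ Z)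
    (hfin : (Z ∩ Set.Ico 0 π).Finite) (hne : Z.Nonempty) :
    ∃ (M : ℕ) (d : ℤ → ℝ), StrictMono d ∧ (∀ t z : ℤ, d (t + M * z) = d t + z * π) ∧
      ∀ x, x ∈ Z ↔ ∃ t, d t = x := by
  classical
  have hred : ∀ x : ℝ, x + (-⌊x / π⌋ : ℤ) * π ∈ Set.Ico 0 π := by
    intro x
    have h1 := Int.floor_le (x / π)
    have h2 := Int.lt_floor_add_one (x / π)
    rw [le_div_iff₀ pi_pos] at h1
    rw [div_lt_iff₀ pi_pos] at h2
    push_cast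
    constructor <;> linarith
  set F := hfin.toFinset with hF
  have hFmem : ∀ x, x ∈ F ↔ x ∈ Z ∧ 0 ≤ x ∧ x < π := fun x => by
    rw [hF, Set.Finite.mem_toFinset]; rfl
  have hM : 0 < F.card := by
    obtain ⟨x, hx⟩ := hne
    exact Finset.card_pos.2 ⟨_, (hFmem _).2 ⟨hper x _ hx, hred x⟩⟩
  have hM' : (0 : ℤ) < F.card := by exact_mod_cast hM
  let e := F.orderEmbOfFin rfl
  have hr : ∀ t : ℤ, (t % F.card).toNat < F.card := fun t => by
    have := Int.emod_nonneg t hM'.ne'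
    have := Int.emod_lt_of_pos t hM'
    omega
  let d : ℤ → ℝ := fun t => e ⟨(t % F.card).toNat, hr t⟩ + (t / F.card : ℤ) * π
  have he : ∀ i, e i ∈ Z ∧ 0 ≤ e i ∧ e i < π := fun i =>
    (hFmem _).1 (Finset.orderEmbOfFin_mem F rfl i)
  have hd : ∀ t z : ℤ, d (t + F.card * z) = d t + z * π := by
    intro t z
    have h1 : (t + F.card * z) % F.card = t % F.card := by simp
    have h2 : (t + F.card * z) / F.card = t / F.card + z := Int.add_mul_ediv_left _ _ hM'.ne'
    simp only [d, h1, h2]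
    push_cast
    ring
  refine ⟨F.card, d, strictMono_int_of_lt_succ fun t => ?_, hd, fun x => ⟨fun hx => ?_, ?_⟩⟩
  · have h1 := Int.emod_nonneg t hM'.ne'
    have h2 := Int.emod_lt_of_pos t hM'
    have h3 := Int.emod_add_mul_ediv t F.card
    by_cases h : t % F.card + 1 < F.card
    · have e1 : (t + 1) / F.card = t / F.card ∧ (t + 1) % F.card = t % F.card + 1 :=
        (Int.ediv_emod_unique hM').2 ⟨by linarith, by omega, h⟩
      simp only [d, e1.1]
      gcongr 1
      rw [OrderEmbedding.lt_iff_lt, Fin.mk_lt_mk]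
      omega
    · have e1 : (t + 1) / F.card = t / F.card + 1 ∧ (t + 1) % F.card = 0 :=
        (Int.ediv_emod_unique hM').2 ⟨by linarith, le_rfl, hM'⟩
      simp only [d, e1.1]
      have a1 := (he ⟨((t + 1) % F.card).toNat, hr (t + 1)⟩).2.1
      have a2 := (he ⟨(t % F.card).toNat, hr t⟩).2.2
      push_cast
      linarith
  · have h1 : x + (-⌊x / π⌋ : ℤ) * π ∈ F := (hFmem _).2 ⟨hper x _ hx, hred x⟩
    have h2 : x + (-⌊x / π⌋ : ℤ) * π ∈ Set.range e := by
      rw [Finset.range_orderEmbOfFin]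
      exact h1
    obtain ⟨i, hi⟩ := h2
    refine ⟨(i : ℕ) + F.card * ⌊x / π⌋, ?_⟩
    rw [hd]
    have h3 : ((i : ℕ) : ℤ) % F.card = (i : ℕ) := Int.emod_eq_of_lt (by omega) (by omega)
    have h4 : ((i : ℕ) : ℤ) / F.card = 0 := Int.ediv_eq_zero_of_lt (by omega) (by omega)
    simp only [d, h3, h4, Int.toNat_natCast, Fin.eta, hi]
    push_cast
    ring
  · rintro ⟨t, rfl⟩
    exact hper _ _ (he _).1

section Rank

variable {α : Type*} [Fintype α] {v w : α → ℝ}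

open Classical in
/-- The number of elements on which `v` is smaller than on `x`. -/
noncomputable def rankOf (v : α → ℝ) (x : α) : ℕ := (Finset.univ.filter fun y => v y < v x).card

theorem rankOf_lt_rankOf {x y : α} (h : v x < v y) : rankOf v x < rankOf v y := by
  classical
  refine Finset.card_lt_card (Finset.ssubset_iff_subset_ne.2 ⟨?_, fun h' => ?_⟩)
  · intro z
    simp only [Finset.mem_filter, Finset.mem_univ, true_and]
    exact fun hz => hz.trans h
  · have : x ∈ Finset.univ.filter fun y => v y < v x := by
      rw [h']
      simpa using h
    simp at this

theorem rankOf_lt_rankOf_iff (hv : Function.Injective v) {x y : α} :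
    rankOf v x < rankOf v y ↔ v x < v y := by
  refine ⟨fun h => ?_, rankOf_lt_rankOf⟩
  rcases lt_trichotomy (v x) (v y) with h' | h' | h'
  · exact h'
  · rw [hv h'] at h
    exact absurd h (lt_irrefl _)
  · exact absurd (rankOf_lt_rankOf h') (by omega)

theorem rankOf_injective (hv : Function.Injective v) : Function.Injective (rankOf v) := by
  intro x y h
  rcases lt_trichotomy (v x) (v y) with h' | h' | h'
  · exact absurd (rankOf_lt_rankOf h') (by omega)
  · exact hv h'
  · exact absurd (rankOf_lt_rankOf h') (by omega)

theorem rankOf_lt_card (x : α) : rankOf v x < Fintype.card α := by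
  classical
  exact Finset.card_lt_univ_of_notMem (x := x) (by simp)

theorem exists_rankOf_eq (hv : Function.Injective v) {p : ℕ} (hp : p < Fintype.card α) :
    ∃ x, rankOf v x = p := by
  let f : α → Fin (Fintype.card α) := fun x => ⟨rankOf v x, rankOf_lt_card x⟩
  have hf : Function.Bijective f := (Fintype.bijective_iff_injective_and_card f).2
    ⟨fun x y h => rankOf_injective hv (congrArg Fin.val h), by simp⟩
  obtain ⟨x, hx⟩ := hf.2 ⟨p, hp⟩
  exact ⟨x, congrArg Fin.val hx⟩

theorem rankOf_neg_add (hv : Function.Injective v) (x : α) :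
    rankOf (fun y => -v y) x + rankOf v x + 1 = Fintype.card α := by
  classical
  have h : (Finset.univ.filter fun y => v x < v y) =
      (Finset.univ.filter fun y => v y < v x)ᶜ.erase x := by
    ext y
    simp only [Finset.mem_filter, Finset.mem_univ, true_and, Finset.mem_erase, Finset.mem_compl,
      not_lt]
    exact ⟨fun h => ⟨fun h' => absurd h (by simp [h']), h.le⟩,
      fun h => lt_of_le_of_ne h.2 fun h' => h.1 (hv h').symm⟩
  have h2 := Finset.card_compl_add_card (Finset.univ.filter fun y => v y < v x)
  have h3 := Finset.card_erase_add_one (s := (Finset.univ.filter fun y => v y < v x)ᶜ) (a := x)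
    (by simp)
  unfold rankOf
  simp only [neg_lt_neg_iff]
  rw [h]
  omega

theorem rankOf_le_succ {x : α}
    (h : ∀ y z, v y < v x → ¬ w y < w x → v z < v x → ¬ w z < w x → y = z) :
    rankOf v x ≤ rankOf w x + 1 := by
  classical
  have h1 : (Finset.univ.filter fun y => v y < v x) ⊆ (Finset.univ.filter fun y => w y < w x) ∪
      (Finset.univ.filter fun y => v y < v x ∧ ¬ w y < w x) := by
    intro y
    simp only [Finset.mem_filter, Finset.mem_univ, true_and, Finset.mem_union]
    tauto
  have h2 : (Finset.univ.filter fun y => v y < v x ∧ ¬ w y < w x).card ≤ 1 := by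
    refine Finset.card_le_one.2 fun y hy z hz => ?_
    simp only [Finset.mem_filter, Finset.mem_univ, true_and] at hy hz
    exact h y z hy.1 hy.2 hz.1 hz.2
  have h3 := Finset.card_le_card h1
  have h4 := Finset.card_union_le (Finset.univ.filter fun y => w y < w x)
    (Finset.univ.filter fun y => v y < v x ∧ ¬ w y < w x)
  unfold rankOf
  omega

end Rank

/-! ### The sweep of a point set -/

open Real

/-- The position of the point `x` in the direction at angle `θ`. -/
noncomputable def proj (θ : ℝ) (x : Plane) : ℝ := x 0 * cos θ + x 1 * sin θ

theorem proj_add_int_mul_two_pi (θ : ℝ) (z : ℤ) (x : Plane) :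
    proj (θ + z * (2 * π)) x = proj θ x := by
  simp [proj]

theorem proj_add_pi (θ : ℝ) (x : Plane) : proj (θ + π) x = -proj θ x := by
  simp only [proj, cos_add_pi, sin_add_pi]
  ring

theorem proj_add_int_mul_pi (θ : ℝ) (z : ℤ) :
    (∀ x, proj (θ + z * π) x = proj θ x) ∨ ∀ x, proj (θ + z * π) x = -proj θ x := by
  rcases Int.even_or_odd' z with ⟨w, rfl | rfl⟩
  · left
    intro x
    rw [← proj_add_int_mul_two_pi θ w]
    congr 1
    push_cast
    ring
  · right
    intro x
    rw [← proj_add_int_mul_two_pi θ w, ← proj_add_pi]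
    congr 1
    push_cast
    ring

theorem continuous_proj (x : Plane) : Continuous fun θ => proj θ x := by
  unfold proj
  fun_prop

/-- Two distinct points are level in only one direction, up to multiples of `π`. -/
theorem exists_eq_add_of_proj_eq {x y : Plane} (hxy : x ≠ y) {θ θ' : ℝ} (h : proj θ x = proj θ y)
    (h' : proj θ' x = proj θ' y) : ∃ z : ℤ, θ' = θ + z * π := by
  unfold proj at h h'
  have h0 : (x 0 - y 0) * sin (θ' - θ) = 0 := by
    rw [sin_sub]
    linear_combination sin θ' * h - sin θ * h'
  have h1 : (x 1 - y 1) * sin (θ' - θ) = 0 := by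
    rw [sin_sub]
    linear_combination cos θ * h' - cos θ' * h
  have h2 : sin (θ' - θ) = 0 := by
    by_contra hs
    refine hxy (PiLp.ext fun i => ?_)
    fin_cases i
    · exact sub_eq_zero.1 ((mul_eq_zero.1 h0).resolve_right hs)
    · exact sub_eq_zero.1 ((mul_eq_zero.1 h1).resolve_right hs)
  obtain ⟨z, hz⟩ := sin_eq_zero_iff.1 h2
  exact ⟨z, by linarith⟩

theorem exists_eq_smul_of_proj_eq {x y : Plane} {θ : ℝ} (h : proj θ x = proj θ y) :
    ∃ r : ℝ, y 0 = x 0 - r * sin θ ∧ y 1 = x 1 + r * cos θ := by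
  unfold proj at h
  have hsc := sin_sq_add_cos_sq θ
  refine ⟨-(y 0 - x 0) * sin θ + (y 1 - x 1) * cos θ, ?_, ?_⟩
  · linear_combination (-cos θ) * h - (y 0 - x 0) * hsc
  · linear_combination (-sin θ) * h - (y 1 - x 1) * hsc

theorem collinear_of_proj_eq {x y z : Plane} {θ : ℝ} (hy : proj θ x = proj θ y)
    (hz : proj θ x = proj θ z) : Collinear ℝ ({x, y, z} : Set Plane) := by
  rw [collinear_iff_of_mem (p₀ := x) (by simp)]
  have key : ∀ y, proj θ x = proj θ y → ∃ r : ℝ, y = r • !₂[-sin θ, cos θ] +ᵥ x := by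
    intro y h
    obtain ⟨r, h0, h1⟩ := exists_eq_smul_of_proj_eq h
    refine ⟨r, PiLp.ext fun i => ?_⟩
    fin_cases i
    · simp [h0]; ring
    · simp [h1]; ring
  refine ⟨!₂[-sin θ, cos θ], fun p hp => ?_⟩
  rcases hp with rfl | rfl | rfl
  · exact key _ rfl
  · exact key _ hy
  · exact key _ hz

theorem exists_proj_eq_between {x y : Plane} {a b : ℝ} (hab : a ≤ b) (ha : proj a x < proj a y)
    (hb : proj b y ≤ proj b x) : ∃ θ, a ≤ θ ∧ θ ≤ b ∧ proj θ x = proj θ y := by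
  have hc : ContinuousOn (fun θ => proj θ x - proj θ y) (Set.Icc a b) :=
    ((continuous_proj x).sub (continuous_proj y)).continuousOn
  obtain ⟨θ, h1, h2⟩ := intermediate_value_Icc hab hc (show (0 : ℝ) ∈ Set.Icc _ _ from
    ⟨by linarith, by linarith⟩)
  exact ⟨θ, h1.1, h1.2, sub_eq_zero.1 h2⟩

theorem exists_proj_eq (x y : Plane) : ∃ θ, proj θ x = proj θ y := by
  have h1 := proj_add_pi 0 x
  have h2 := proj_add_pi 0 y
  rw [zero_add] at h1 h2
  rcases lt_trichotomy (proj 0 x) (proj 0 y) with h | h | h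
  · obtain ⟨θ, -, -, h⟩ := exists_proj_eq_between pi_pos.le h (by linarith)
    exact ⟨θ, h⟩
  · exact ⟨0, h⟩
  · obtain ⟨θ, -, -, h⟩ := exists_proj_eq_between pi_pos.le h (by linarith)
    exact ⟨θ, h.symm⟩

/-- The directions in which two points of `P` are level, enumerated increasingly by `angle`, where
`half` of them lie in a half-turn. -/
structure TieAngles (P : Finset Plane) where
  half : ℕ
  angle : ℤ → ℝ
  strictMono : StrictMono angle
  angle_add_mul : ∀ t z : ℤ, angle (t + half * z) = angle t + z * π
  tie_iff : ∀ θ, (∃ x ∈ P, ∃ y ∈ P, x ≠ y ∧ proj θ x = proj θ y) ↔ ∃ t, angle t = θ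

theorem nonempty_tieAngles {P : Finset Plane} (hP : 2 ≤ P.card) : Nonempty (TieAngles P) := by
  suffices h : ∃ (M : ℕ) (d : ℤ → ℝ), StrictMono d ∧ (∀ t z : ℤ, d (t + M * z) = d t + z * π) ∧
      ∀ θ, θ ∈ {θ | ∃ x ∈ P, ∃ y ∈ P, x ≠ y ∧ proj θ x = proj θ y} ↔ ∃ t, d t = θ by
    obtain ⟨M, d, h1, h2, h3⟩ := h
    exact ⟨⟨M, d, h1, h2, h3⟩⟩
  refine exists_enumeration_of_periodic ?_ ?_ ?_
  · rintro θ z ⟨x, hx, y, hy, hne, h⟩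
    refine ⟨x, hx, y, hy, hne, ?_⟩
    rcases proj_add_int_mul_pi θ z with h' | h' <;> rw [h', h', h]
  · have : {θ | ∃ x ∈ P, ∃ y ∈ P, x ≠ y ∧ proj θ x = proj θ y} ∩ Set.Ico 0 π ⊆
        ⋃ x ∈ P, ⋃ y ∈ P, {θ | (x ≠ y ∧ proj θ x = proj θ y) ∧ θ ∈ Set.Ico 0 π} := by
      rintro θ ⟨⟨x, hx, y, hy, h⟩, h'⟩
      simp only [Set.mem_iUnion]
      exact ⟨x, hx, y, hy, h, h'⟩
    refine Set.Finite.subset ?_ this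
    refine P.finite_toSet.biUnion fun x _ => P.finite_toSet.biUnion fun y _ => ?_
    refine Set.Subsingleton.finite ?_
    rintro θ ⟨⟨hne, h⟩, h0, h1⟩ θ' ⟨⟨-, h'⟩, h0', h1'⟩
    obtain ⟨z, rfl⟩ := exists_eq_add_of_proj_eq hne h h'
    have hz1 : (z : ℝ) < 1 := by
      by_contra hz
      nlinarith [pi_pos]
    have hz2 : (-1 : ℝ) < z := by
      by_contra hz
      nlinarith [pi_pos]
    have hz : z = 0 := by
      have : z < 1 := by exact_mod_cast hz1
      have : -1 < z := by exact_mod_cast hz2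
      omega
    simp [hz]
  · obtain ⟨x, hx, y, hy, hne⟩ := Finset.one_lt_card.1 (by omega : 1 < P.card)
    obtain ⟨θ, hθ⟩ := exists_proj_eq x y
    exact ⟨θ, x, hx, y, hy, hne, hθ⟩

namespace TieAngles

variable {P : Finset Plane} (D : TieAngles P)

/-- A direction between `angle (t - 1)` and `angle t`, in which no two points of `P` are level. -/
noncomputable def mid (t : ℤ) : ℝ := (D.angle (t - 1) + D.angle t) / 2

theorem mid_lt (t : ℤ) : D.mid t < D.angle t := by
  have := D.strictMono (show t - 1 < t by omega)
  unfold mid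
  linarith

theorem lt_mid (t : ℤ) : D.angle t < D.mid (t + 1) := by
  have := D.strictMono (show t < t + 1 by omega)
  unfold mid
  rw [add_sub_cancel_right]
  linarith

theorem mid_add_half (t : ℤ) : D.mid (t + D.half) = D.mid t + π := by
  have h1 := D.angle_add_mul (t - 1) 1
  have h2 := D.angle_add_mul t 1
  simp only [mul_one, Int.cast_one, one_mul] at h1 h2
  unfold mid
  rw [← sub_add_eq_add_sub, h1, h2]
  ring

theorem eq_of_tie {x y : Plane} (hx : x ∈ P) (hy : y ∈ P) (hne : x ≠ y) {θ : ℝ} {t : ℤ}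
    (h : proj θ x = proj θ y) (h1 : D.mid t ≤ θ) (h2 : θ ≤ D.mid (t + 1)) : θ = D.angle t := by
  obtain ⟨s, rfl⟩ := (D.tie_iff θ).1 ⟨x, hx, y, hy, hne, h⟩
  have h3 := D.lt_mid (t - 1)
  rw [sub_add_cancel] at h3
  have h4 := D.mid_lt (t + 1)
  have h5 := D.strictMono.lt_iff_lt.1 (h3.trans_le h1)
  have h6 := D.strictMono.lt_iff_lt.1 (h2.trans_lt h4)
  congr 1
  omega

theorem mid_proj_injOn {x y : Plane} (hx : x ∈ P) (hy : y ∈ P) {t : ℤ}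
    (h : proj (D.mid t) x = proj (D.mid t) y) : x = y := by
  by_contra hne
  have h1 := D.mid_lt t
  have h2 := D.lt_mid t
  have := D.eq_of_tie hx hy hne h le_rfl (h1.trans h2).le
  exact h1.ne this

theorem tie_of_flip {x y : Plane} (hx : x ∈ P) (hy : y ∈ P) {t : ℤ}
    (h : proj (D.mid t) x < proj (D.mid t) y)
    (h' : proj (D.mid (t + 1)) y ≤ proj (D.mid (t + 1)) x) :
    proj (D.angle t) x = proj (D.angle t) y := by
  have hne : x ≠ y := by
    rintro rfl
    exact lt_irrefl _ h
  obtain ⟨θ, h1, h2, h3⟩ := exists_proj_eq_between ((D.mid_lt t).trans (D.lt_mid t)).le h h'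
  rwa [D.eq_of_tie hx hy hne h3 h1 h2] at h3

theorem eq_of_ties (hP : InGeneralPosition P) {x y z : Plane} (hx : x ∈ P) (hy : y ∈ P) (hz : z ∈ P)
    {θ : ℝ} (hxy : x ≠ y) (hxz : x ≠ z) (h1 : proj θ x = proj θ y) (h2 : proj θ x = proj θ z) :
    y = z := by
  by_contra hyz
  exact hP x hx y hy z hz hxy hxz hyz (collinear_of_proj_eq h1 h2)

theorem mid_lt_iff_angle_lt {x z : Plane} (hx : x ∈ P) (hz : z ∈ P) {t : ℤ}
    (h : proj (D.angle t) z ≠ proj (D.angle t) x) :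
    proj (D.mid t) z < proj (D.mid t) x ↔ proj (D.angle t) z < proj (D.angle t) x := by
  have hne : z ≠ x := by
    rintro rfl
    exact h rfl
  have key : ∀ {x z}, x ∈ P → z ∈ P → z ≠ x → proj (D.angle t) z ≠ proj (D.angle t) x →
      proj (D.mid t) z < proj (D.mid t) x → proj (D.angle t) z < proj (D.angle t) x := by
    intro x z hx hz hne h h1
    by_contra h2
    obtain ⟨θ, h3, h4, h5⟩ := exists_proj_eq_between (D.mid_lt t).le h1 (not_lt.1 h2)
    rw [D.eq_of_tie hz hx hne h5 h3 (h4.trans (D.lt_mid t).le)] at h5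
    exact h h5
  refine ⟨key hx hz hne h, fun h1 => ?_⟩
  rcases lt_trichotomy (proj (D.mid t) z) (proj (D.mid t) x) with h2 | h2 | h2
  · exact h2
  · exact absurd (D.mid_proj_injOn hz hx h2) hne
  · exact absurd (key hz hx hne.symm h.symm h2) h1.not_gt

theorem injective_proj (t : ℤ) : Function.Injective fun x : P => proj (D.mid t) x :=
  fun x y h => Subtype.ext (D.mid_proj_injOn x.2 y.2 h)

theorem neg_proj (t : ℤ) : (fun x : P => proj (D.mid (t + D.half)) x) =
    fun x : P => -proj (D.mid t) x := by
  funext x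
  rw [mid_add_half, proj_add_pi]

/-- The sweep of a point set: the points are ordered by their projections to a rotating line. A step
of the sweep passes one direction in which points are level, so that a point can only be overtaken
by one other point. -/
noncomputable def sweep (hP : InGeneralPosition P) : Sweep P.card D.half P where
  pos t := rankOf fun x : P => proj (D.mid t) x
  pos_lt t x := by simpa using rankOf_lt_card (v := fun x : P => proj (D.mid t) x) x
  inj t := rankOf_injective (D.injective_proj t)
  surj t p hp := exists_rankOf_eq (D.injective_proj t) (by simpa using hp)
  step_le t x := by
    refine rankOf_le_succ fun y z hy hy' hz hz' => Subtype.ext ?_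
    have hne : ∀ {y : P}, proj (D.mid (t + 1)) y < proj (D.mid (t + 1)) x → (x : Plane) ≠ y := by
      intro y h h'
      rw [h'] at h
      exact lt_irrefl _ h
    refine eq_of_ties hP x.2 y.2 z.2 (hne hy) (hne hz) (θ := D.angle t) ?_ ?_
    · refine D.tie_of_flip x.2 y.2 (lt_of_le_of_ne (not_lt.1 hy') fun h => hne hy ?_) hy.le
      exact D.mid_proj_injOn x.2 y.2 h
    · refine D.tie_of_flip x.2 z.2 (lt_of_le_of_ne (not_lt.1 hz') fun h => hne hz ?_) hz.le
      exact D.mid_proj_injOn x.2 z.2 h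
  le_step t x := by
    refine rankOf_le_succ fun y z hy hy' hz hz' => Subtype.ext ?_
    have hne : ∀ {y : P}, proj (D.mid t) y < proj (D.mid t) x → (x : Plane) ≠ y := by
      intro y h h'
      rw [h'] at h
      exact lt_irrefl _ h
    exact eq_of_ties hP x.2 y.2 z.2 (hne hy) (hne hz) (θ := D.angle t)
      (D.tie_of_flip y.2 x.2 hy (not_lt.1 hy')).symm (D.tie_of_flip z.2 x.2 hz (not_lt.1 hz')).symm
  reverse t x := by
    rw [neg_proj, rankOf_neg_add (D.injective_proj t)]
    simp
  dvd_of_crossings x y t t' h1 h2 h3 h4 := by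
    rw [rankOf_lt_rankOf_iff (D.injective_proj _)] at h1 h2 h3 h4
    have hne : (x : Plane) ≠ y := by
      intro h
      rw [h] at h1
      exact lt_irrefl _ h1
    obtain ⟨z, hz⟩ := exists_eq_add_of_proj_eq hne (D.tie_of_flip x.2 y.2 h1 h2.le)
      (D.tie_of_flip x.2 y.2 h3 h4.le)
    rw [← D.angle_add_mul] at hz
    rw [D.strictMono.injective hz]
    simp

theorem sweep_lt_iff (hP : InGeneralPosition P) {t : ℤ} {x y : P} :
    (D.sweep hP).pos t x < (D.sweep hP).pos t y ↔ proj (D.mid t) x < proj (D.mid t) y :=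
  rankOf_lt_rankOf_iff (D.injective_proj t)

/-- When `x` is overtaken by `y`, the line through them leaves on one side the points in front of
both. -/
theorem numLeft_of_crosses (hP : InGeneralPosition P) {t : ℤ} {x y : P}
    (h : (D.sweep hP).Crosses t x y) :
    numLeft P x y = (D.sweep hP).pos t x ∨ numLeft P y x = (D.sweep hP).pos t x := by
  classical
  have h1 := (D.sweep_lt_iff hP).1 h.1
  have h2 := (D.sweep_lt_iff hP).1 h.2
  have htie := D.tie_of_flip x.2 y.2 h1 h2.le
  have hne : (x : Plane) ≠ y := fun h' => h.ne (Subtype.ext h')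
  have hlt : ∀ z : P, proj (D.mid t) z < proj (D.mid t) x ↔
      proj (D.angle t) z < proj (D.angle t) x := by
    intro z
    by_cases hz : proj (D.angle t) z = proj (D.angle t) x
    · rw [iff_false_right hz.not_lt]
      by_cases hzx : (x : Plane) = z
      · rw [hzx]
        exact lt_irrefl _
      · rw [eq_of_ties hP x.2 z.2 y.2 hzx hne hz.symm htie]
        exact h1.not_gt
    · exact D.mid_lt_iff_angle_lt x.2 z.2 hz
  have hpos : (D.sweep hP).pos t x =
      (P.filter fun z => proj (D.angle t) z < proj (D.angle t) x).card := by
    refine Finset.card_bij (fun z _ => (z : Plane)) ?_ (fun a _ b _ h => Subtype.ext h) ?_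
    · intro z hz
      rw [Finset.mem_filter] at hz ⊢
      exact ⟨z.2, (hlt z).1 hz.2⟩
    · intro z hz
      rw [Finset.mem_filter] at hz
      refine ⟨⟨z, hz.1⟩, ?_, rfl⟩
      rw [Finset.mem_filter]
      exact ⟨Finset.mem_univ _, (hlt ⟨z, hz.1⟩).2 hz.2⟩
  rw [hpos]
  -- The vector from `x` to `y` is orthogonal to the direction `angle t`.
  obtain ⟨r, hr0, hr1⟩ := exists_eq_smul_of_proj_eq htie
  have hr : r ≠ 0 := by
    rintro rfl
    refine hne (PiLp.ext fun i => ?_)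
    fin_cases i
    · simpa using hr0.symm
    · simpa using hr1.symm
  have ha : ∀ z, signedArea x y z = r * (proj (D.angle t) x - proj (D.angle t) z) := by
    intro z
    simp only [signedArea, proj, hr0, hr1]
    ring
  have hb : ∀ z, signedArea y x z = -r * (proj (D.angle t) x - proj (D.angle t) z) := by
    intro z
    simp only [signedArea, proj, hr0, hr1]
    ring
  rcases lt_or_gt_of_ne hr with h | h
  · right
    unfold numLeft
    congr 1
    refine Finset.filter_congr fun z _ => ?_
    rw [hb, mul_pos_iff_of_pos_left (by linarith), sub_pos]
  · left
    unfold numLeft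
    congr 1
    refine Finset.filter_congr fun z _ => ?_
    rw [ha, mul_pos_iff_of_pos_left h, sub_pos]

/-- In a full period, the exchanges of the positions `k` and `k + 1` come from different
`k`-edges. -/
theorem cnt_sweep_le (hP : InGeneralPosition P) {k : ℕ} (hk : 2 * (k + 1) < P.card) (s : ℤ) :
    (D.sweep hP).cnt (k + 1) s (s + 2 * D.half) ≤ numKEdges P k := by
  classical
  refine Finset.card_le_card_of_forall_subsingleton (fun t e => ∃ x y : P,
    (D.sweep hP).Crosses t x y ∧ (D.sweep hP).pos t y = k + 1 ∧
      e = {(x : Plane), (y : Plane)}) ?_ ?_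
  · intro t ht
    obtain ⟨x, y, hxy, hy⟩ := (Finset.mem_filter.1 ht).2
    have hne : (x : Plane) ≠ y := fun h' => hxy.ne (Subtype.ext h')
    refine ⟨{(x : Plane), (y : Plane)}, ?_, x, y, hxy, hy, rfl⟩
    rw [Finset.mem_filter, Finset.mem_powersetCard]
    refine ⟨⟨?_, Finset.card_pair hne⟩, ?_⟩
    · intro z hz
      rw [Finset.mem_insert, Finset.mem_singleton] at hz
      rcases hz with rfl | rfl
      · exact x.2
      · exact y.2
    · have e := hxy.eqs
      rcases D.numLeft_of_crosses hP hxy with h | h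
      · exact ⟨x, x.2, y, y.2, hne, rfl, by omega⟩
      · exact ⟨y, y.2, x, x.2, hne.symm, Finset.pair_comm _ _, by omega⟩
  · rintro e - t ⟨ht, x, y, hxy, hy, he⟩ t' ⟨ht', x', y', hxy', hy', he'⟩
    rw [Finset.mem_filter, Finset.mem_Ico] at ht ht'
    rw [he, ← Finset.coe_inj, Finset.coe_pair, Finset.coe_pair, Set.pair_eq_pair_iff] at he'
    rcases he' with ⟨h1, h2⟩ | ⟨h1, h2⟩
    · obtain rfl := Subtype.ext h1
      obtain rfl := Subtype.ext h2
      obtain ⟨z, rfl⟩ := hxy.two_dvd hxy'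
      have hz1 : z < 1 := by
        by_contra hz
        nlinarith [ht.1, ht'.1]
      have hz2 : -1 < z := by
        by_contra hz
        nlinarith [ht.1, ht'.1]
      have : z = 0 := by omega
      simp [this]
    · obtain rfl := Subtype.ext h1
      obtain rfl := Subtype.ext h2
      have := hxy.pos_add hxy'
      omega

end TieAngles

/-! ### Triangles with prescribed directions -/

section Triangle

/-- The determinant of two vectors of the plane. -/
def cross (v w : Plane) : ℝ := v 0 * w 1 - v 1 * w 0

theorem affineIndependent_of_cross_ne_zero {p q r : Plane} (h : cross (q - p) (r - p) ≠ 0) :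
    AffineIndependent ℝ ![p, q, r] := by
  rw [affineIndependent_iff_not_collinear_set, collinear_iff_of_mem (p₀ := p) (by simp)]
  rintro ⟨v, hv⟩
  obtain ⟨a, ha⟩ := hv q (by simp)
  obtain ⟨b, hb⟩ := hv r (by simp)
  apply h
  rw [ha, hb]
  simp only [cross, vadd_eq_add, add_sub_cancel_right, PiLp.smul_apply, smul_eq_mul]
  ring

/-- Scaling a nondegenerate triangle about an interior point makes it enclose any finite set. -/
theorem exists_triangle_of_cross_ne_zero (P : Finset Plane) {v w : Plane} (h : cross v w ≠ 0) :
    ∃ (T : Affine.Triangle ℝ Plane) (R : ℝ), 0 < R ∧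
      (P : Set Plane) ⊆ interior (convexHull ℝ (Set.range T.points)) ∧
      T.points 1 - T.points 0 = R • v ∧ T.points 2 - T.points 1 = R • w ∧
      T.points 0 - T.points 2 = -(R • (v + w)) := by
  have hind : AffineIndependent ℝ ![(0 : Plane), v, v + w] := by
    apply affineIndependent_of_cross_ne_zero
    convert h using 1
    simp only [cross, sub_zero, PiLp.add_apply]
    ring
  have hspan : affineSpan ℝ (Set.range ![(0 : Plane), v, v + w]) = ⊤ := by
    rw [hind.affineSpan_eq_top_iff_card_eq_finrank_add_one]
    simp
  obtain ⟨c, hc⟩ := interior_convexHull_nonempty_iff_affineSpan_eq_top.2 hspan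
  obtain ⟨ε, hε, hball⟩ := Metric.isOpen_iff.1 isOpen_interior c hc
  obtain ⟨B, hB⟩ := P.finite_toSet.isBounded.subset_ball c
  set R := max 1 (B / ε) with hR
  have hR0 : 0 < R := lt_max_of_lt_left one_pos
  have hRB : B ≤ R * ε := by
    rw [← div_le_iff₀ hε]
    exact le_max_right _ _
  let φ : Plane → Plane := fun x => R • (x - c) + c
  have hφ : φ = AffineMap.homothety c R := by
    funext x
    simp [φ, AffineMap.homothety_apply]
  have hind' : AffineIndependent ℝ ![φ 0, φ v, φ (v + w)] := by
    apply affineIndependent_of_cross_ne_zero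
    have : cross (φ v - φ 0) (φ (v + w) - φ 0) = R * R * cross v w := by
      simp only [cross, φ, PiLp.sub_apply, PiLp.add_apply, PiLp.smul_apply, smul_eq_mul,
        PiLp.zero_apply]
      ring
    rw [this]
    exact mul_ne_zero (mul_ne_zero hR0.ne' hR0.ne') h
  refine ⟨⟨_, hind'⟩, R, hR0, ?_, ?_, ?_, ?_⟩
  · have himg : Set.range ![φ 0, φ v, φ (v + w)] = φ '' Set.range ![(0 : Plane), v, v + w] := by
      rw [← Set.range_comp]
      congr 1
      funext i
      fin_cases i <;> rfl
    dsimp only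
    rw [himg, hφ, ← AffineMap.image_convexHull, ← hφ]
    refine hB.trans (interior_maximal ?_ Metric.isOpen_ball)
    intro x hx
    refine ⟨R⁻¹ • (x - c) + c, interior_subset (hball ?_), ?_⟩
    · rw [mem_ball_iff_norm] at hx ⊢
      rw [add_sub_cancel_right, norm_smul, norm_inv, Real.norm_of_nonneg hR0.le,
        inv_mul_lt_iff₀ hR0]
      linarith
    · simp only [φ, add_sub_cancel_right, smul_smul, mul_inv_cancel₀ hR0.ne', one_smul,
        sub_add_cancel]
  · simp [φ, smul_sub]
  · simp only [φ]
    simp [smul_sub, smul_add]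
  · simp only [φ]
    simp [smul_sub, smul_add]
    abel

/-- Three pairwise independent directions are the directions of the sides of a triangle enclosing
a given finite set, since they satisfy a linear relation with nonzero coefficients. -/
theorem exists_triangle_of_directions (P : Finset Plane) {w₀ w₁ w₂ : Plane} (h01 : cross w₀ w₁ ≠ 0)
    (h12 : cross w₁ w₂ ≠ 0) (h20 : cross w₂ w₀ ≠ 0) :
    ∃ (T : Affine.Triangle ℝ Plane) (c₀ c₁ c₂ : ℝ), c₀ ≠ 0 ∧ c₁ ≠ 0 ∧ c₂ ≠ 0 ∧
      (P : Set Plane) ⊆ interior (convexHull ℝ (Set.range T.points)) ∧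
      T.points 1 - T.points 0 = c₀ • w₀ ∧ T.points 2 - T.points 1 = c₁ • w₁ ∧
      T.points 0 - T.points 2 = c₂ • w₂ := by
  have hrel : cross w₁ w₂ • w₀ + cross w₂ w₀ • w₁ = -(cross w₀ w₁ • w₂) := by
    refine PiLp.ext fun i => ?_
    fin_cases i <;>
    · simp only [cross, PiLp.add_apply, PiLp.smul_apply, PiLp.neg_apply, smul_eq_mul, Fin.zero_eta,
        Fin.mk_one]
      ring
  have hcr : cross (cross w₁ w₂ • w₀) (cross w₂ w₀ • w₁) ≠ 0 := by
    have : cross (cross w₁ w₂ • w₀) (cross w₂ w₀ • w₁) =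
        cross w₁ w₂ * cross w₂ w₀ * cross w₀ w₁ := by
      simp only [cross, PiLp.smul_apply, smul_eq_mul]
      ring
    rw [this]
    exact mul_ne_zero (mul_ne_zero h12 h20) h01
  obtain ⟨T, R, hR, hP, h1, h2, h3⟩ := exists_triangle_of_cross_ne_zero P hcr
  refine ⟨T, R * cross w₁ w₂, R * cross w₂ w₀, R * cross w₀ w₁, mul_ne_zero hR.ne' h12,
    mul_ne_zero hR.ne' h20, mul_ne_zero hR.ne' h01, hP, ?_, ?_, ?_⟩
  · rw [h1, smul_smul]
  · rw [h2, smul_smul]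
  · rw [h3, hrel, smul_neg, neg_neg, smul_smul]

end Triangle

/-! ### Decomposing point sets -/

theorem inner_eq_proj (θ : ℝ) (x : Plane) : inner ℝ (!₂[cos θ, sin θ] : Plane) x = proj θ x := by
  simp [proj, PiLp.inner_apply, Fin.sum_univ_two]

theorem cross_directions (θ θ' : ℝ) :
    cross (!₂[cos θ, sin θ] : Plane) !₂[cos θ', sin θ'] = sin (θ' - θ) := by
  rw [sin_sub]
  simp only [cross, Matrix.cons_val_zero, Matrix.cons_val_one]
  ring

/-- The projection order `X, Y, Z` along a direction is seen on every parallel line. -/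
theorem projectionShowsBetween_of_lt {u v : Plane} {θ c : ℝ} (hc : c ≠ 0)
    (huv : v - u = c • (!₂[cos θ, sin θ] : Plane)) {X Y Z : Finset Plane}
    (hXY : ∀ x ∈ X, ∀ y ∈ Y, proj θ x < proj θ y) (hYZ : ∀ y ∈ Y, ∀ z ∈ Z, proj θ y < proj θ z) :
    ProjectionShowsBetween u v Z Y X := by
  unfold ProjectionShowsBetween
  rw [huv]
  simp only [real_inner_smul_left, inner_eq_proj]
  rcases lt_or_gt_of_ne hc with h | h
  · left
    exact fun y hy => ⟨fun z hz => mul_lt_mul_of_neg_left (hYZ y hy z hz) h,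
      fun x hx => mul_lt_mul_of_neg_left (hXY x hx y hy) h⟩
  · right
    exact fun y hy => ⟨fun x hx => mul_lt_mul_of_pos_left (hXY x hx y hy) h,
      fun z hz => mul_lt_mul_of_pos_left (hYZ y hy z hz) h⟩

theorem isThreeDecomposable_empty : IsThreeDecomposable ∅ := by
  obtain ⟨T, -, -, hT, -⟩ := exists_triangle_of_cross_ne_zero ∅ (v := !₂[(1 : ℝ), 0])
    (w := !₂[(0 : ℝ), 1]) (by simp [cross])
  exact ⟨∅, ∅, ∅, by simp, by simp, by simp, by simp, rfl, rfl, T, hT, by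
    simp [ProjectionShowsBetween], by simp [ProjectionShowsBetween],
    by simp [ProjectionShowsBetween]⟩

theorem numKEdges_eq {P : Finset Plane} {n : ℕ}
    (h : ∀ k : ℕ, 3 * k < n → numLEKEdges P k = 3 * (k + 2).choose 2) {k : ℕ} (hk : 3 * k < n) :
    numKEdges P k = 3 * (k + 1) := by
  rcases k with _ | k
  · simpa [numLEKEdges] using h 0 hk
  · have h1 := h (k + 1) hk
    have h2 := h k (by omega)
    unfold numLEKEdges at h1 h2
    have h3 := AllowableSequence.choose_two_succ (k + 2)
    rw [Finset.sum_range_succ, h2, show k + 1 + 2 = (k + 2) + 1 by ring] at h1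
    omega

/-- The points of the three blocks appear in the orders `A B C`, `B C A` and `C A B` along three
directions of the sweep, which serve as the sides of the triangle. -/
theorem isThreeDecomposable_of_numLEKEdges {P : Finset Plane} (hn : 3 ∣ P.card)
    (hP : InGeneralPosition P)
    (h : ∀ k : ℕ, 3 * k < P.card → numLEKEdges P k = 3 * (k + 2).choose 2) :
    IsThreeDecomposable P := by
  classical
  obtain ⟨m, hm⟩ := hn
  rcases Nat.eq_zero_or_pos m with rfl | hm0
  · rw [Finset.card_eq_zero.1 hm]
    exact isThreeDecomposable_empty
  obtain ⟨D⟩ := nonempty_tieAngles (P := P) (by omega)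
  obtain ⟨Q, a, b, hQ, hd, hab, ha, hmid, -, hlast⟩ := (D.sweep hP).exists_three_blocks hm hm0 (by
    intro k hk hkm s
    obtain ⟨l, rfl⟩ : ∃ l, k = l + 1 := ⟨k - 1, by omega⟩
    rw [← numKEdges_eq h (by omega)]
    exact D.cnt_sweep_le hP (by omega) s)
  have hlast' : ∀ i x, x ∈ Q (i + 2) ↔ 2 * m ≤ (D.sweep hP).pos (a i) x := fun i x =>
    hlast i (a i) x le_rfl (hab i)
  let θ : ℤ → ℝ := fun i => D.mid (a i)
  have h01 : ∀ i, ∀ x ∈ Q i, ∀ y ∈ Q (i + 1), proj (θ i) x < proj (θ i) y := by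
    intro i x hx y hy
    rw [← D.sweep_lt_iff hP]
    have h1 := (ha i x).1 hx
    have h2 := (hmid i y).1 hy
    omega
  have h12 : ∀ i, ∀ x ∈ Q (i + 1), ∀ y ∈ Q (i + 2), proj (θ i) x < proj (θ i) y := by
    intro i x hx y hy
    rw [← D.sweep_lt_iff hP]
    have h1 := (hmid i x).1 hx
    have h2 := (hlast' i y).1 hy
    omega
  have hne : ∀ i, ∃ x, x ∈ Q i := by
    intro i
    obtain ⟨x, hx⟩ := (D.sweep hP).surj (a i) 0 (by omega)
    exact ⟨x, (ha i x).2 (by omega)⟩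
  have hcross : ∀ i j, Q j = Q (i + 1) → Q (j + 1) = Q (i + 2) → Q (j + 2) = Q i →
      cross (!₂[cos (θ i), sin (θ i)] : Plane) !₂[cos (θ j), sin (θ j)] ≠ 0 := by
    intro i j hj0 hj1 hj2
    rw [cross_directions]
    intro hs
    obtain ⟨z, hz⟩ := sin_eq_zero_iff.1 hs
    have hz' : θ j = θ i + z * π := by linarith
    obtain ⟨x, hx⟩ := hne i
    obtain ⟨y, hy⟩ := hne (i + 1)
    obtain ⟨w, hw⟩ := hne (i + 2)
    have e1 := h01 i x hx y hy
    have e2 := h12 i y hy w hw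
    have e3 := h01 j y (hj0 ▸ hy) w (hj1 ▸ hw)
    have e4 := h12 j w (hj1 ▸ hw) x (hj2 ▸ hx)
    rw [hz'] at e3 e4
    rcases proj_add_int_mul_pi (θ i) z with hp | hp <;> rw [hp, hp] at e3 e4 <;> linarith
  have hQ3 : Q 3 = Q 0 := hQ 0
  have hQ4 : Q 4 = Q 1 := hQ 1
  obtain ⟨T, c₀, c₁, c₂, hc₀, hc₁, hc₂, hT, hs₀, hs₁, hs₂⟩ := exists_triangle_of_directions P
    (hcross 2 0 hQ3.symm hQ4.symm rfl) (hcross 0 1 rfl rfl hQ3) (hcross 1 2 rfl rfl hQ4)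
  let X : ℤ → Finset Plane := fun i => (Q i).map (Function.Embedding.subtype _)
  have hX : ∀ i p, p ∈ X i → ∃ x ∈ Q i, (x : Plane) = p := fun i p hp => by
    simpa [X] using hp
  have hshow : ∀ i {u v : Plane} {c : ℝ}, c ≠ 0 →
      v - u = c • (!₂[cos (θ i), sin (θ i)] : Plane) →
      ProjectionShowsBetween u v (X (i + 2)) (X (i + 1)) (X i) := by
    intro i u v c hc huv
    refine projectionShowsBetween_of_lt hc huv ?_ ?_
    · intro p hp q hq
      obtain ⟨x, hx, rfl⟩ := hX _ _ hp
      obtain ⟨y, hy, rfl⟩ := hX _ _ hq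
      exact h01 i x hx y hy
    · intro p hp q hq
      obtain ⟨x, hx, rfl⟩ := hX _ _ hp
      obtain ⟨y, hy, rfl⟩ := hX _ _ hq
      exact h12 i x hx y hy
  have hX3 : X 3 = X 0 := by simp only [X, hQ3]
  have hX4 : X 4 = X 1 := by simp only [X, hQ4]
  have hdisj : ∀ i, Disjoint (X i) (X (i + 1)) := fun i =>
    (Finset.disjoint_map _).2 (hd i)
  have hcard : ∀ i, (X i).card = m := by
    intro i
    have : Q i = (D.sweep hP).pre m (a i) := by
      ext x
      rw [ha, Sweep.mem_pre]
    rw [Finset.card_map, this, Sweep.card_pre (by omega)]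
  refine ⟨X 0, X 1, X 2, hdisj 0, ?_, hdisj 1, ?_, by rw [hcard, hcard], by rw [hcard, hcard], T,
    hT, ?_, ?_, ?_⟩
  · rw [← hX3]
    exact (hdisj 2).symm
  · simp only [X, ← Finset.map_union]
    have : Q 0 ∪ Q 1 ∪ Q 2 = Finset.univ := by
      refine Finset.eq_univ_of_forall fun x => ?_
      have h0 := ha 0 x
      have h1 : x ∈ Q 1 ↔ _ := hmid 0 x
      have h2 : x ∈ Q 2 ↔ _ := hlast' 0 x
      rw [Finset.mem_union, Finset.mem_union, h0, h1, h2]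
      omega
    rw [this]
    ext p
    simp
  · have := hshow 2 hc₀ hs₀
    rwa [show (2 : ℤ) + 2 = 4 by norm_num, show (2 : ℤ) + 1 = 3 by norm_num, hX3, hX4] at this
  · exact hshow 0 hc₁ hs₁
  · have := hshow 1 hc₂ hs₂
    rwa [show (1 : ℤ) + 2 = 3 by norm_num, hX3] at this

theorem theorem1 (n : ℕ) (hn : 3 ∣ n) :
    (∀ P : Finset Plane, P.card = n → InGeneralPosition P →
      (∀ k : ℕ, 3 * k < n → numLEKEdges P k = 3 * (k + 2).choose 2) →
      IsThreeDecomposable P) ∧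
    (∀ (α : Type*) (S : AllowableSequence n α) (s : ℤ),
      (∀ k : ℕ, 3 * k < n → S.numLEKEdges s k = 3 * (k + 2).choose 2) →
      S.IsThreeDecomposable) := by
  refine ⟨?_, fun α S s h => AllowableSequence.isThreeDecomposable_of_numLEKEdges hn h⟩
  rintro P rfl hP h
  exact isThreeDecomposable_of_numLEKEdges hn hP h
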